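/- Let $(\varphi_e)_{e\in\mathbb N}$ be the standard enumeration of the partial computable functions $\mathbb N\rightharpoonup\mathbb N$. For a group $G$, regarded as a structure in the signature $\{\cdot,{}^{-1},1\}$, the index set $I(G)$ is the set of all $e\in\mathbb N$ such that $\varphi_e$ is the characteristic function of (the set of Gödel numbers of) the atomic diagram of a structure $B$ with universe a subset of $\mathbb N$ and $B\cong G$; here the atomic diagram of $B$ is the set of all atomic and negated atomic sentences, with constants naming the elements of $B$, that are true in $B$. A set $S\subseteq\mathbb N$ is d-$\Sigma_2$ if $S=S_1\smallsetminus S_2$ for some $\Sigma_2$ sets $S_2\subseteq S_1\subseteq\mathbb N$. For a class $\Gamma$ of subsets of $\mathbb N$, a set $T\subseteq\mathbb N$ is $\Gamma$-hard if every $S\in\Gamma$ is many-one reducible to $T$ by a total computable function, and it is $m$-complete $\Gamma$ if moreover $T\in\Gamma$. A group is co-Hopfian if it is not isomorphic to any of its proper subgroups. Theorem. Let $N$ be a finitely generated nilpotent group. Then the index set $I(N)$ is $\Pi_2$-hard. If, furthermore, $N$ is not co-Hopfian, then $I(N)$ is $m$-complete d-$\Sigma_2$. -/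

import Mathlib

namespace CompGroup

/-! ## The atomic diagram of a group whose universe is a set of natural numbers -/

/-- Closed terms in the signature of groups (product, inverse, identity) expanded by a constant
for every element of `A`. -/
inductive GTerm (A : Type) : Type
  | const : A → GTerm A
  | one : GTerm A
  | inv : GTerm A → GTerm A
  | mul : GTerm A → GTerm A → GTerm A

/-- The value of a closed term in a group. -/
def GTerm.eval {A : Type} [Group A] : GTerm A → A
  | .const a => a
  | .one => 1
  | .inv t => (t.eval)⁻¹
  | .mul t s => t.eval * s.eval

/-- The Gödel number of a term whose constants are natural numbers. -/
def GTerm.code {U : Set ℕ} : GTerm U → ℕ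
  | .one => 0
  | .const a => 3 * (a : ℕ) + 1
  | .inv t => 3 * t.code + 2
  | .mul t s => 3 * Nat.pair t.code s.code + 3

/-- The Gödel number of the atomic sentence `t = s`. -/
def codeEq {U : Set ℕ} (t s : GTerm U) : ℕ := 2 * Nat.pair t.code s.code

/-- The Gödel number of the negated atomic sentence `t ≠ s`. -/
def codeNe {U : Set ℕ} (t s : GTerm U) : ℕ := 2 * Nat.pair t.code s.code + 1

/-- The atomic diagram of a group with universe `U ⊆ ℕ`: the (Gödel numbers of the) atomic and
negated atomic sentences, with constants naming the elements of `U`, that are true in it. -/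
def atomicDiagram (U : Set ℕ) [Group U] : Set ℕ :=
  {c | ∃ t s : GTerm U,
    (c = codeEq t s ∧ t.eval = s.eval) ∨ (c = codeNe t s ∧ t.eval ≠ s.eval)}

/-! ## Index sets -/

/-- The `e`-th partial computable function `φ_e`. -/
def phi (e : ℕ) : ℕ →. ℕ := (Denumerable.ofNat Nat.Partrec.Code e).eval

/-- The partial function `f` is the characteristic function of `D`; in particular it is total. -/
def IsCharFun (f : ℕ →. ℕ) (D : Set ℕ) : Prop :=
  ∀ x, (x ∈ D → f x = Part.some 1) ∧ (x ∉ D → f x = Part.some 0)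

/-- The index set of `G`: all `e` such that `φ_e` is the characteristic function of the atomic
diagram of a structure, with universe a set of natural numbers, that is isomorphic to `G`. -/
def indexSet (G : Type*) [Group G] : Set ℕ :=
  {e | ∃ (U : Set ℕ) (_ : Group U), Nonempty (U ≃* G) ∧ IsCharFun (phi e) (atomicDiagram U)}

/-! ## Complexity classes, hardness and completeness -/

/-- `S` is a `Σ₂` set of natural numbers. -/
def IsSigma2 (S : Set ℕ) : Prop :=
  ∃ R : ℕ × ℕ × ℕ → Prop, ComputablePred R ∧ ∀ n, n ∈ S ↔ ∃ a, ∀ b, R (n, a, b)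

/-- `S` is a `Π₂` set of natural numbers. -/
def IsPi2 (S : Set ℕ) : Prop :=
  ∃ R : ℕ × ℕ × ℕ → Prop, ComputablePred R ∧ ∀ n, n ∈ S ↔ ∀ a, ∃ b, R (n, a, b)

/-- `S` is a d-`Σ₂` set: a difference `S₁ \ S₂` of two `Σ₂` sets `S₂ ⊆ S₁`. -/
def IsDSigma2 (S : Set ℕ) : Prop :=
  ∃ S₁ S₂ : Set ℕ, IsSigma2 S₁ ∧ IsSigma2 S₂ ∧ S₂ ⊆ S₁ ∧ S = S₁ \ S₂

/-- `T` is `Γ`-hard: every set in `Γ` is many-one reducible to `T` by a total computable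
function. -/
def IsHard (Γ : Set ℕ → Prop) (T : Set ℕ) : Prop :=
  ∀ S : Set ℕ, Γ S → ManyOneReducible (fun n => n ∈ S) (fun e => e ∈ T)

/-- `T` is `m`-complete `Γ`. -/
def IsMComplete (Γ : Set ℕ → Prop) (T : Set ℕ) : Prop :=
  Γ T ∧ IsHard Γ T

/-! ## Co-Hopfian groups -/

/-- A group is co-Hopfian if none of its proper subgroups is isomorphic to it. -/
def IsCoHopfian (G : Type*) [Group G] : Prop :=
  ∀ H : Subgroup G, Nonempty (H ≃* G) → H = ⊤

end CompGroup

/-! Throughout, `G` is a finitely generated nilpotent group with generating tuple `x`.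

Computable copy. `G` is built from the trivial group by adjoining one element `t` at a time to a
normal subgroup `K`. Elements of the new group are written `k * t ^ p * (t ^ q)⁻¹`, conjugation by
`t` is computable because `K` is finitely generated, and `K ∩ ⟨t⟩` is described by a single
exponent; so decidability of the word problem passes up (`Numbering.sup_zpowers`,
`nonempty_numbering`).

Hardness. Given a computable copy, an algorithm computing its atomic diagram can be made to wait at
input `x` for a witness of the `x`-th instance of a `Π₂` condition. The computed function is total
exactly when the condition holds, which gives `Π₂`-hardness. If `G` is not co-Hopfian, an injective
`ψ : G → G` that is not onto yields a strictly ascending union `G → G → ⋯`, which is not finitely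
generated. A c.e. subgroup of this union climbs one stage whenever the next candidate witness for a
`Σ₂` condition is refuted. It stops at a copy of `G` if the condition holds and exhausts the union
otherwise. Coding `S₁` by the subgroup and the complement of `S₂` by totality gives
`isHard_isDSigma2`.

Upper bound. A finite list of relators, together with vanishing of a term of the lower central
series, presents `G` (`exists_isRelatorList`), so whether a tuple is the image of `x` under a
homomorphism is a finite set of equations. A tuple `g` is good if it satisfies exactly the relations
of `x` and is not the image, under any homomorphism from `G`, of a tuple lying in the kernel of a
nontrivial character of `G` to a finite cyclic group. The tuple `x` is good: otherwise an
endomorphism would map a proper subgroup onto `G`, against the Hopf property. Conversely a good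
tuple of `G` generates `G`, since a proper subgroup lies in the kernel of such a character. Hence `H
≃* G` iff `H` has a good tuple and every good tuple generates `H` (`nonempty_mulEquiv_iff`).
Goodness is a universal condition over the atomic diagram, so the first clause is `Σ₂` and the
second `Π₂`; being the diagram of a group is also `Π₂`. The index set is therefore a difference of
`Π₂` sets, that is, d-`Σ₂`. -/

namespace CompGroup

/-! ## Terms over the natural numbers -/

/-- Recursion over terms. -/
def GTerm.fold {A : Type} {σ : Type*} (c : A → σ) (o : σ) (i : σ → σ) (m : σ × σ → σ) :
    GTerm A → σ
  | .const a => c a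
  | .one => o
  | .inv t => i (t.fold c o i m)
  | .mul t s => m (t.fold c o i m, s.fold c o i m)

/-- The Gödel number of a term over `ℕ`. -/
def GTerm.toNat (t : GTerm ℕ) : ℕ :=
  t.fold (fun a => 3 * a + 1) 0 (fun t => 3 * t + 2) (fun p => 3 * Nat.pair p.1 p.2 + 3)

/-- The term over `ℕ` with a given Gödel number. -/
def GTerm.ofNat : ℕ → GTerm ℕ
  | 0 => .one
  | k + 1 =>
    if k % 3 = 0 then .const (k / 3)
    else if k % 3 = 1 then .inv (GTerm.ofNat (k / 3))
    else .mul (GTerm.ofNat (k / 3).unpair.1) (GTerm.ofNat (k / 3).unpair.2)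
decreasing_by
  · omega
  · have := Nat.unpair_left_le (k / 3); omega
  · have := Nat.unpair_right_le (k / 3); omega

theorem GTerm.ofNat_toNat (t : GTerm ℕ) : GTerm.ofNat t.toNat = t := by
  induction t with
  | const a =>
    have h1 : 3 * a % 3 = 0 := by omega
    have h2 : 3 * a / 3 = a := by omega
    simp [toNat, fold, ofNat]
  | one => simp [toNat, fold, ofNat]
  | inv t ih =>
    have h1 : (3 * t.toNat + 1) % 3 = 1 := by omega
    have h2 : (3 * t.toNat + 1) / 3 = t.toNat := by omega
    change ofNat (3 * t.toNat + 1 + 1) = _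
    rw [ofNat, h1, h2, ih]; simp
  | mul t s iht ihs =>
    have h1 : (3 * Nat.pair t.toNat s.toNat + 2) % 3 = 2 := by omega
    have h2 : (3 * Nat.pair t.toNat s.toNat + 2) / 3 = Nat.pair t.toNat s.toNat := by omega
    change ofNat (3 * Nat.pair t.toNat s.toNat + 2 + 1) = _
    rw [ofNat, h1, h2]; simp [iht, ihs]

theorem GTerm.toNat_ofNat (n : ℕ) : (GTerm.ofNat n).toNat = n := by
  induction n using Nat.strong_induction_on with
  | _ n ih =>
    cases n with
    | zero => simp [toNat, fold, ofNat]
    | succ k =>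
      rw [ofNat]
      split_ifs with h0 h1
      · change 3 * (k / 3) + 1 = _
        omega
      · change 3 * (ofNat (k / 3)).toNat + 2 = _
        rw [ih _ (by omega)]; omega
      · change 3 * Nat.pair (ofNat (k / 3).unpair.1).toNat (ofNat (k / 3).unpair.2).toNat + 3 = _
        have := Nat.unpair_left_le (k / 3)
        have := Nat.unpair_right_le (k / 3)
        rw [ih _ (by omega), ih _ (by omega), Nat.pair_unpair]; omega

/-- Terms over `ℕ` correspond to their Gödel numbers. -/
def GTerm.equivNat : GTerm ℕ ≃ ℕ := ⟨toNat, ofNat, ofNat_toNat, toNat_ofNat⟩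

instance : Primcodable (GTerm ℕ) := Primcodable.ofEquiv ℕ GTerm.equivNat

theorem GTerm.computable_toNat : Computable GTerm.toNat :=
  (Primrec.of_equiv (e := GTerm.equivNat)).to_comp

theorem GTerm.computable_ofNat : Computable GTerm.ofNat :=
  (Primrec.of_equiv_symm (e := GTerm.equivNat)).to_comp

theorem GTerm.computable_const : Computable (GTerm.const (A := ℕ)) :=
  (computable_ofNat.comp (Primrec.nat_add.comp (Primrec.nat_mul.comp (.const 3) .id)
    (.const 1)).to_comp).of_eq fun a => ofNat_toNat (.const a)

theorem GTerm.computable_inv : Computable (GTerm.inv (A := ℕ)) :=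
  (computable_ofNat.comp ((Primrec.nat_add.comp (Primrec.nat_mul.comp (.const 3) .id)
    (.const 2)).to_comp.comp computable_toNat)).of_eq fun a => ofNat_toNat (.inv a)

theorem GTerm.computable_mul : Computable₂ (GTerm.mul (A := ℕ)) :=
  (computable_ofNat.comp ((Primrec.nat_add.comp (Primrec.nat_mul.comp (.const 3) .id)
    (.const 3)).to_comp.comp (Primrec₂.natPair.to_comp.comp
      (computable_toNat.comp .fst) (computable_toNat.comp .snd)))).of_eq
        fun a => ofNat_toNat (.mul a.1 a.2)

/-! ### Computability of recursion over terms. -/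

section Fold

variable {α σ : Type*} [Primcodable α] [Primcodable σ]

/-- Subterms have smaller Gödel numbers, so this is course-of-values recursion on codes. All later
computations on terms are instances of it. -/
theorem GTerm.computable_fold {c : α → ℕ → σ} {o : α → σ} {i : α → σ → σ} {m : α → σ × σ → σ}
    (hc : Computable₂ c) (ho : Computable o) (hi : Computable₂ i) (hm : Computable₂ m) :
    Computable₂ fun (a : α) (t : GTerm ℕ) => t.fold (c a) (o a) (i a) (m a) := by
  -- `L` lists the values at all smaller codes, so `L.length` is the current code. Code 0 is the
  -- identity, and `k % 3` tells the other constructors apart.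
  let g : α → List σ → Option σ := fun a L =>
    Nat.casesOn L.length (some (o a)) fun k =>
      Nat.casesOn (k % 3) (some (c a (k / 3))) fun r =>
        Nat.casesOn r (L[k / 3]?.map (i a)) fun _ =>
          L[(k / 3).unpair.1]?.bind fun x => L[(k / 3).unpair.2]?.map fun y => m a (x, y)
  have hg : Computable₂ g := by
    refine Computable.nat_casesOn (Computable.list_length.comp .snd)
      (Computable.option_some.comp (ho.comp .fst)) ?_
    have d3 : Computable fun n : ℕ => n / 3 := (Primrec.nat_div.comp .id (.const 3)).to_comp
    have m3 : Computable fun n : ℕ => n % 3 := (Primrec.nat_mod.comp .id (.const 3)).to_comp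
    refine Computable.nat_casesOn (m3.comp .snd) (Computable.option_some.comp
      (hc.comp (Computable.fst.comp .fst) (d3.comp .snd))) ?_
    refine Computable.nat_casesOn .snd (Computable.option_map (Computable.list_getElem?.comp
      (Computable.snd.comp (Computable.fst.comp .fst)) (d3.comp (Computable.snd.comp .fst)))
      (hi.comp (Computable.fst.comp (Computable.fst.comp (Computable.fst.comp .fst))) .snd)) ?_
    refine Computable.option_bind (Computable.list_getElem?.comp
      (Computable.snd.comp (Computable.fst.comp (Computable.fst.comp .fst)))
      (Computable.fst.comp (Computable.unpair.comp (d3.comp (Computable.snd.comp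
        (Computable.fst.comp .fst)))))) ?_
    refine Computable.option_map (Computable.list_getElem?.comp
      (Computable.snd.comp (Computable.fst.comp (Computable.fst.comp (Computable.fst.comp .fst))))
      (Computable.snd.comp (Computable.unpair.comp (d3.comp (Computable.snd.comp
        (Computable.fst.comp (Computable.fst.comp .fst))))))) ?_
    exact hm.comp (Computable.fst.comp (Computable.fst.comp (Computable.fst.comp
      (Computable.fst.comp (Computable.fst.comp .fst)))))
      ((Computable.snd.comp .fst).pair .snd)
  have H : Computable₂ fun (a : α) (n : ℕ) => (ofNat n).fold (c a) (o a) (i a) (m a) := by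
    refine Computable.nat_strong_rec _ hg fun a n => ?_
    cases n with
    | zero => simp [g, ofNat, fold]
    | succ k =>
      have h1 := Nat.unpair_left_le (k / 3)
      have h2 := Nat.unpair_right_le (k / 3)
      have e0 : (List.range (k + 1))[k / 3]? = some (k / 3) := by
        rw [List.getElem?_range]; omega
      have e1 : (List.range (k + 1))[(k / 3).unpair.1]? = some (k / 3).unpair.1 := by
        rw [List.getElem?_range]; omega
      have e2 : (List.range (k + 1))[(k / 3).unpair.2]? = some (k / 3).unpair.2 := by
        rw [List.getElem?_range]; omega
      rw [ofNat]
      have h3 : k % 3 = 0 ∨ k % 3 = 1 ∨ k % 3 = 2 := by omega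
      rcases h3 with h | h | h
      · simp [g, h, fold]
      · simp [g, h, fold, e0]
      · simp only [g, h, List.length_map, List.length_range, List.getElem?_map, e1, e2]
        rfl
  exact (H.comp .fst (computable_toNat.comp .snd)).of_eq fun p => by simp [ofNat_toNat]

end Fold

/-- Substitution of terms for constants. -/
def GTerm.bind {A B : Type} (f : A → GTerm B) (t : GTerm A) : GTerm B :=
  t.fold f .one .inv fun p => .mul p.1 p.2

/-- The value of a term under an assignment of group elements to constants. -/
def GTerm.lift {A : Type} {G : Type*} [Group G] (f : A → G) (t : GTerm A) : G :=
  t.fold f 1 (·⁻¹) fun p => p.1 * p.2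

/-! ### Evaluation and substitution of terms. -/

namespace GTerm

variable {A B : Type} {G H : Type*} [Group G] [Group H]

@[simp] theorem lift_const (f : A → G) (a : A) : (const a).lift f = f a := rfl
@[simp] theorem lift_one (f : A → G) : one.lift f = 1 := rfl
@[simp] theorem lift_inv (f : A → G) (t : GTerm A) : (inv t).lift f = (t.lift f)⁻¹ := rfl
@[simp] theorem lift_mul (f : A → G) (t s : GTerm A) :
    (mul t s).lift f = t.lift f * s.lift f := rfl

@[simp] theorem bind_const (f : A → GTerm B) (a : A) : (const a).bind f = f a := rfl
@[simp] theorem bind_one (f : A → GTerm B) : one.bind f = one := rfl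
@[simp] theorem bind_inv (f : A → GTerm B) (t : GTerm A) : (inv t).bind f = inv (t.bind f) := rfl
@[simp] theorem bind_mul (f : A → GTerm B) (t s : GTerm A) :
    (mul t s).bind f = mul (t.bind f) (s.bind f) := rfl

theorem lift_bind (f : A → GTerm B) (g : B → G) (t : GTerm A) :
    (t.bind f).lift g = t.lift fun a => (f a).lift g := by
  induction t <;> simp_all

theorem map_lift (φ : G →* H) (f : A → G) (t : GTerm A) :
    φ (t.lift f) = t.lift fun a => φ (f a) := by
  induction t <;> simp_all

theorem lift_mem {K : Subgroup G} {f : A → G} (hf : ∀ a, f a ∈ K) (t : GTerm A) :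
    t.lift f ∈ K := by
  induction t with
  | const a => exact hf a
  | one => exact K.one_mem
  | inv t ih => exact K.inv_mem ih
  | mul t s iht ihs => exact K.mul_mem iht ihs

theorem exists_lift_eq_of_mem_closure {f : A → G} {x : G}
    (hx : x ∈ Subgroup.closure (Set.range f)) : ∃ t : GTerm A, t.lift f = x := by
  induction hx using Subgroup.closure_induction with
  | mem x hx => obtain ⟨a, rfl⟩ := hx; exact ⟨const a, rfl⟩
  | one => exact ⟨one, rfl⟩
  | mul x y _ _ hx hy =>
    obtain ⟨⟨t, rfl⟩, ⟨s, rfl⟩⟩ := hx, hy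
    exact ⟨mul t s, rfl⟩
  | inv x _ hx => obtain ⟨t, rfl⟩ := hx; exact ⟨inv t, rfl⟩

theorem eval_eq_lift {A : Type} [Group A] (t : GTerm A) : t.eval = t.lift id := by
  induction t <;> simp_all [eval]

end GTerm

end CompGroup

namespace CompGroup

/-! ## Computably numbered groups -/

theorem _root_.Computable.iterate {α σ : Type*} [Primcodable α] [Primcodable σ] {n : α → ℕ}
    {x : α → σ} {f : σ → σ} (hn : Computable n) (hx : Computable x) (hf : Computable f) :
    Computable fun a => f^[n a] (x a) := by
  refine (Computable.nat_rec (h := fun _ p => f p.2) hn hx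
    (hf.comp (Computable.snd.comp .snd))).of_eq fun a => ?_
  induction n a with
  | zero => rfl
  | succ k ih => rw [Function.iterate_succ_apply', ← ih]

/-- The extension of a finite sequence by a default value. -/
def finExt {σ : Type*} {n : ℕ} (g : Fin n → σ) (d : σ) (i : ℕ) : σ := (List.ofFn g).getD i d

theorem finExt_fin {σ : Type*} {n : ℕ} (g : Fin n → σ) (d : σ) (j : Fin n) :
    finExt g d j = g j := by
  simp [finExt]

theorem finExt_of_le {σ : Type*} {n : ℕ} (g : Fin n → σ) (d : σ) {i : ℕ} (h : n ≤ i) :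
    finExt g d i = d := by
  simp [finExt, h]

theorem apply_finExt {σ τ : Type*} {n : ℕ} (F : σ → τ) (g : Fin n → σ) (d : σ) (i : ℕ) :
    F (finExt g d i) = finExt (fun j => F (g j)) (F d) i := by
  rcases lt_or_ge i n with h | h
  · rw [finExt_fin g d ⟨i, h⟩, finExt_fin _ _ ⟨i, h⟩]
  · rw [finExt_of_le _ _ h, finExt_of_le _ _ h]

theorem finExt_cases {σ : Type*} {n : ℕ} {g : Fin n → σ} {d : σ} {P : σ → Prop}
    (hg : ∀ j, P (g j)) (hd : P d) (i : ℕ) : P (finExt g d i) := by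
  rcases lt_or_ge i n with h | h
  · rw [finExt_fin g d ⟨i, h⟩]; exact hg _
  · rw [finExt_of_le _ _ h]; exact hd

theorem computable_finExt {α σ : Type*} [Primcodable α] [Primcodable σ] {n : ℕ}
    {g : α → Fin n → σ} (hg : ∀ j, Computable fun a => g a j) (d : σ) :
    Computable₂ fun a i => finExt (g a) d i := by
  have h : Computable fun a => List.ofFn (g a) := Computable.list_ofFn hg
  exact (Primrec.list_getD d).to_comp.comp (h.comp .fst) .snd

theorem closure_range_finExt {G : Type*} [Group G] {n : ℕ} (g : Fin n → G) :
    Subgroup.closure (Set.range (finExt g 1)) = Subgroup.closure (Set.range g) := by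
  refine le_antisymm (Subgroup.closure_le _ |>.2 ?_) (Subgroup.closure_mono ?_)
  · rintro _ ⟨i, rfl⟩
    exact finExt_cases (P := (· ∈ Subgroup.closure (Set.range g)))
      (fun j => Subgroup.subset_closure ⟨j, rfl⟩) (one_mem _) i
  · rintro _ ⟨j, rfl⟩
    exact ⟨j, finExt_fin _ _ _⟩

theorem exists_fin_generators (G : Type*) [Group G] [hG : Group.FG G] :
    ∃ (n : ℕ) (x : Fin n → G), Subgroup.closure (Set.range x) = ⊤ := by
  obtain ⟨S, hS⟩ := Group.fg_def.1 hG
  refine ⟨S.card, fun j => S.equivFin.symm j, ?_⟩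
  rw [← hS]
  congr 1
  ext y
  exact ⟨fun ⟨j, hj⟩ => hj ▸ (S.equivFin.symm j).2, fun h => ⟨S.equivFin ⟨y, h⟩, by simp⟩⟩

/-- A numbering of a group by natural numbers for which the product is computable and the
triviality of elements is decidable. -/
structure Numbering (G : Type*) [Group G] where
  val : ℕ → G
  surj : Function.Surjective val
  mul : ℕ → ℕ → ℕ
  computable_mul : Computable₂ mul
  val_mul : ∀ x y, val (mul x y) = val x * val y
  computablePred_eq_one : ComputablePred fun x => val x = 1

namespace Numbering

variable {G H : Type*} [Group G] [Group H] (N : Numbering G)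

/-- Transport of a numbering along an isomorphism. -/
def ofEquiv (e : G ≃* H) : Numbering H where
  val x := e (N.val x)
  surj := e.surjective.comp N.surj
  mul := N.mul
  computable_mul := N.computable_mul
  val_mul x y := by simp [N.val_mul]
  computablePred_eq_one := N.computablePred_eq_one.of_eq fun x => by simp

/-- Search for a right inverse: it exists by surjectivity, and it is recognized by the decidable
triviality of the product. -/
theorem exists_inv : ∃ i : ℕ → ℕ, Computable i ∧ ∀ x, N.val (i x) = (N.val x)⁻¹ := by
  classical
  have hex : ∀ x, ∃ y, N.val (N.mul x y) = 1 := fun x => by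
    obtain ⟨y, hy⟩ := N.surj (N.val x)⁻¹
    exact ⟨y, by rw [N.val_mul, hy, mul_inv_cancel]⟩
  have hc : ComputablePred fun p : ℕ × ℕ => N.val (N.mul p.1 p.2) = 1 :=
    Computable.computablePred (N.computablePred_eq_one.decide.comp
      (N.computable_mul.comp .fst .snd))
  refine ⟨_, Computable.find (P := fun x y => N.val (N.mul x y) = 1) hc hex, fun x => ?_⟩
  have := Nat.find_spec (hex x)
  rw [N.val_mul] at this
  exact eq_inv_of_mul_eq_one_right this

theorem computablePred_eq : ComputablePred fun p : ℕ × ℕ => N.val p.1 = N.val p.2 := by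
  classical
  obtain ⟨i, hi, hv⟩ := N.exists_inv
  refine ComputablePred.of_eq (p := fun p : ℕ × ℕ => N.val (N.mul p.1 (i p.2)) = 1)
    (Computable.computablePred (N.computablePred_eq_one.decide.comp
      (N.computable_mul.comp .fst (hi.comp .snd)))) fun p => ?_
  rw [N.val_mul, hv, mul_inv_eq_one]

theorem exists_pow : ∃ F : ℕ → ℕ → ℕ, Computable₂ F ∧ ∀ x n, N.val (F x n) = N.val x ^ n := by
  obtain ⟨u, hu⟩ := N.surj 1
  have hF : Computable fun p : ℕ × ℕ => Nat.rec (motive := fun _ => ℕ) u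
      (fun _ ih => N.mul ih p.1) p.2 :=
    Computable.nat_rec (h := fun (p : ℕ × ℕ) (q : ℕ × ℕ) => N.mul q.2 p.1) .snd (.const u)
      (N.computable_mul.comp (Computable.snd.comp .snd) (Computable.fst.comp .fst))
  refine ⟨fun x n => Nat.rec (motive := fun _ => ℕ) u (fun _ ih => N.mul ih x) n, hF, fun x n => ?_⟩
  induction n with
  | zero => simpa using hu
  | succ k ih => rw [pow_succ, ← ih, ← N.val_mul]

theorem exists_term_value {α : Type*} [Primcodable α] {c : α → ℕ → ℕ} (hc : Computable₂ c) :
    ∃ F : α → GTerm ℕ → ℕ, Computable₂ F ∧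
      ∀ a t, N.val (F a t) = t.lift fun i => N.val (c a i) := by
  obtain ⟨u, hu⟩ := N.surj 1
  obtain ⟨i, hi, hv⟩ := N.exists_inv
  refine ⟨fun a t => t.fold (c a) u i fun p => N.mul p.1 p.2,
    GTerm.computable_fold (i := fun _ x => i x) (m := fun _ p => N.mul p.1 p.2) hc (.const u)
      (hi.comp .snd) (N.computable_mul.comp (Computable.fst.comp .snd) (Computable.snd.comp .snd)),
      fun a t => ?_⟩
  induction t with
  | const b => rfl
  | one => exact hu
  | inv t ih => simp only [GTerm.fold, GTerm.lift_inv, hv, ih]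
  | mul t s iht ihs => simp only [GTerm.fold, GTerm.lift_mul, N.val_mul, iht, ihs]

/-- Homomorphisms out of a finitely generated group are computable. -/
theorem exists_hom [Group.FG G] (M : Numbering H) (φ : G →* H) :
    ∃ f : ℕ → ℕ, Computable f ∧ ∀ x, M.val (f x) = φ (N.val x) := by
  classical
  obtain ⟨n, g, hg⟩ := exists_fin_generators G
  choose c hc using fun j => N.surj (g j)
  choose d hd using fun j => M.surj (φ (g j))
  obtain ⟨u, hu⟩ := N.surj 1
  obtain ⟨v, hv⟩ := M.surj 1
  have e1 : (fun i => N.val (finExt c u i)) = finExt g 1 := by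
    funext i; rw [apply_finExt N.val]; simp only [hc, hu]
  have e2 : (fun i => M.val (finExt d v i)) = fun i => φ (finExt g 1 i) := by
    funext i; rw [apply_finExt M.val, apply_finExt φ]; simp only [hd, hv, map_one]
  obtain ⟨F, hF, hFv⟩ := N.exists_term_value (α := Unit) (c := fun _ => finExt c u)
    (computable_finExt (fun j => .const (c j)) u)
  obtain ⟨F', hF', hFv'⟩ := M.exists_term_value (α := Unit) (c := fun _ => finExt d v)
    (computable_finExt (fun j => .const (d j)) v)
  -- To compute the homomorphism at `x`, search for a term in the generators with value `x`, then
  -- evaluate that term at the images of the generators.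
  have hex : ∀ x, ∃ k, N.val (F () (GTerm.ofNat k)) = N.val x := fun x => by
    obtain ⟨t, ht⟩ := GTerm.exists_lift_eq_of_mem_closure (f := finExt g 1) (x := N.val x)
      (by rw [closure_range_finExt, hg]; trivial)
    exact ⟨t.toNat, by rw [GTerm.ofNat_toNat, hFv, e1, ht]⟩
  have hcomp : ComputablePred fun p : ℕ × ℕ => N.val (F () (GTerm.ofNat p.2)) = N.val p.1 :=
    Computable.computablePred (N.computablePred_eq.decide.comp
      ((hF.comp (.const ()) (GTerm.computable_ofNat.comp .snd)).pair .fst))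
  have hfind := Computable.find (P := fun x k => N.val (F () (GTerm.ofNat k)) = N.val x) hcomp hex
  refine ⟨_, hF'.comp (.const ()) (GTerm.computable_ofNat.comp hfind), fun x => ?_⟩
  have h := Nat.find_spec (hex x)
  generalize Nat.find (hex x) = k at h ⊢
  rw [hFv', ← h, hFv, e1, e2, GTerm.map_lift]

/-- The exponents in question form a subgroup of `ℤ`, which is cyclic. The case `m = 0` is allowed
and means that only exponent 0 occurs. -/
theorem exists_zpow_mem_iff (K : Subgroup G) (t : G) : ∃ m : ℕ, ∀ z : ℤ, t ^ z ∈ K ↔ (m : ℤ) ∣ z := by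
  let A : AddSubgroup ℤ :=
    { carrier := {z | t ^ z ∈ K}
      zero_mem' := by simp
      add_mem' := fun {a b} ha hb => by
        change t ^ (a + b) ∈ K
        rw [zpow_add]; exact K.mul_mem ha hb
      neg_mem' := fun {a} ha => by
        change t ^ (-a) ∈ K
        rw [zpow_neg]; exact K.inv_mem ha }
  obtain ⟨a, ha⟩ := Int.subgroup_cyclic A
  refine ⟨a.natAbs, fun z => ?_⟩
  change z ∈ A ↔ _
  rw [ha, Int.natCast_natAbs, abs_dvd, AddSubgroup.mem_closure_singleton]
  exact ⟨fun ⟨k, hk⟩ => ⟨k, by rw [← hk]; simp [mul_comm]⟩,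
    fun ⟨k, hk⟩ => ⟨k, by rw [hk]; simp [mul_comm]⟩⟩

/-- A numbering of an extension by a cyclic group. -/
theorem sup_zpowers {K : Subgroup G} [K.Normal] [Group.FG K] (N : Numbering K) (t : G) :
    Nonempty (Numbering ↥(K ⊔ Subgroup.zpowers t)) := by
  classical
  obtain ⟨f, hf, hfv⟩ := N.exists_hom N (MulAut.conjNormal t : MulAut K).toMonoidHom
  obtain ⟨f', hf', hfv'⟩ := N.exists_hom N (MulAut.conjNormal t⁻¹ : MulAut K).toMonoidHom
  have hfv1 : ∀ x, (N.val (f x) : G) = t * N.val x * t⁻¹ := fun x => by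
    rw [hfv]; simp
  have hfv1' : ∀ x, (N.val (f' x) : G) = t⁻¹ * N.val x * t := fun x => by
    rw [hfv']; simp
  have hfi : ∀ p x, (N.val (f^[p] x) : G) = t ^ p * N.val x * (t ^ p)⁻¹ := fun p x => by
    induction p with
    | zero => simp
    | succ p ih => rw [Function.iterate_succ_apply', hfv1, ih]; group
  have hfi' : ∀ p x, (N.val (f'^[p] x) : G) = (t ^ p)⁻¹ * N.val x * t ^ p := fun p x => by
    induction p with
    | zero => simp
    | succ p ih => rw [Function.iterate_succ_apply', hfv1', ih]; group
  obtain ⟨m, hm⟩ := exists_zpow_mem_iff K t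
  have hmK : t ^ m ∈ K := by simpa using (hm m).2 dvd_rfl
  obtain ⟨k0, hk0⟩ := N.surj ⟨t ^ m, hmK⟩
  obtain ⟨P, hP, hPv⟩ := N.exists_pow
  have hk0v : ∀ d, m ∣ d → (N.val (P k0 (d / m)) : G) = t ^ d := fun d hd => by
    rw [hPv, hk0]
    simp [← pow_mul, Nat.mul_div_cancel' hd]
  -- An integer exponent is coded as a difference `p - q` of naturals, so that products only add
  -- exponents.
  let val : ℕ → ℕ → ℕ → G := fun a p q => N.val a * t ^ p * (t ^ q)⁻¹
  have hval : ∀ a p q, val a p q ∈ K ⊔ Subgroup.zpowers t := fun a p q =>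
    mul_mem (mul_mem (Subgroup.mem_sup_left (N.val a).2)
      (Subgroup.mem_sup_right (Subgroup.npow_mem_zpowers t p)))
      (Subgroup.mem_sup_right (inv_mem (Subgroup.npow_mem_zpowers t q)))
  -- If the element is trivial, the power of `t` lies in `K`, so `m` divides the exponent and that
  -- power equals `(t ^ m)` to the quotient. The question becomes one inside `K`. The split on `q ≤
  -- p` keeps the subtraction in `ℕ`.
  have htriv : ∀ a p q, val a p q = 1 ↔
      (q ≤ p ∧ m ∣ p - q ∧ N.val (N.mul a (P k0 ((p - q) / m))) = 1) ∨
      (¬ q ≤ p ∧ m ∣ q - p ∧ N.val a = N.val (P k0 ((q - p) / m))) := fun a p q => by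
    have h0 : val a p q = 1 → t ^ ((q : ℤ) - p) ∈ K := fun h => by
      have : t ^ ((q : ℤ) - p) = N.val a := by
        have h' : (N.val a : G) = t ^ q * (t ^ p)⁻¹ := by
          simp only [val] at h
          rw [mul_assoc, mul_eq_one_iff_eq_inv] at h
          rw [h]; group
        rw [h', zpow_sub, zpow_natCast, zpow_natCast]
      rw [this]; exact (N.val a).2
    by_cases hqp : q ≤ p
    · obtain ⟨d, rfl⟩ := Nat.exists_eq_add_of_le hqp
      have e : val a (q + d) q = N.val a * t ^ d := by
        simp only [val]; rw [add_comm, pow_add]; group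
      simp only [hqp, true_and, not_true, false_and, or_false, Nat.add_sub_cancel_left]
      have hd : (∃ _ : val a (q + d) q = 1, True) → m ∣ d := fun ⟨h, _⟩ => by
        have := (hm _).1 (h0 h)
        push_cast at this
        rw [show (q : ℤ) - (q + d) = -d by ring, dvd_neg] at this
        exact_mod_cast this
      constructor
      · intro h
        have hd' := hd ⟨h, trivial⟩
        refine ⟨hd', Subtype.ext ?_⟩
        rw [N.val_mul, Subgroup.coe_mul, hk0v _ hd', ← e, h]; rfl
      · rintro ⟨hd', h⟩
        have := congrArg Subtype.val h
        rw [N.val_mul, Subgroup.coe_mul, hk0v _ hd', ← e] at this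
        exact this
    · obtain ⟨d, rfl⟩ := Nat.exists_eq_add_of_le (le_of_not_ge hqp)
      have e : val a p (p + d) = N.val a * (t ^ d)⁻¹ := by
        simp only [val]; rw [add_comm, pow_add]; group
      simp only [hqp, false_and, not_false_iff, true_and, false_or, Nat.add_sub_cancel_left]
      constructor
      · intro h
        have hd' : m ∣ d := by
          have := (hm _).1 (h0 h)
          push_cast at this
          rw [show (p : ℤ) + d - p = d by ring] at this
          exact_mod_cast this
        refine ⟨hd', Subtype.ext ?_⟩
        rw [hk0v _ hd']
        rw [e, mul_inv_eq_one] at h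
        exact h
      · rintro ⟨hd', h⟩
        rw [e, mul_inv_eq_one, h, hk0v _ hd']
  let A : ℕ → ℕ := fun x => x.unpair.1
  let B : ℕ → ℕ := fun x => x.unpair.2.unpair.1
  let C : ℕ → ℕ := fun x => x.unpair.2.unpair.2
  have hA : Computable A := Computable.fst.comp .unpair
  have hB : Computable B := Computable.fst.comp (Computable.unpair.comp (Computable.snd.comp .unpair))
  have hC : Computable C := Computable.snd.comp (Computable.unpair.comp (Computable.snd.comp .unpair))
  have hadd : Computable₂ fun x y : ℕ => x + y := Primrec.nat_add.to_comp
  have hsub : Computable₂ fun x y : ℕ => x - y := Primrec.nat_sub.to_comp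
  have hdiv : Computable fun x : ℕ => x / m := (Primrec.nat_div.comp .id (.const m)).to_comp
  have hdvd : Computable fun x : ℕ => decide (m ∣ x) :=
    ((Primrec.eq (α := ℕ)).decide.comp (Primrec.nat_mod.comp .id (.const m)) (.const 0)).to_comp.of_eq
      fun x => by simp [Nat.dvd_iff_mod_eq_zero]
  have hle : Computable₂ fun x y : ℕ => decide (x ≤ y) := Primrec.nat_le.decide.to_comp
  -- To multiply, the `K`-part of `y` is moved to the left past `t ^ p * (t ^ q)⁻¹`: this conjugates
  -- it `q` times by `t⁻¹`, then `p` times by `t`.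
  refine ⟨⟨fun x => ⟨val (A x) (B x) (C x), hval _ _ _⟩, ?_, fun x y =>
    Nat.pair (N.mul (A x) (f^[B x] (f'^[C x] (A y)))) (Nat.pair (B x + B y) (C x + C y)), ?_, ?_, ?_⟩⟩
  · rintro ⟨g, hg⟩
    obtain ⟨k, hk, z, hz, rfl⟩ := Subgroup.mem_sup_of_normal_left.1 hg
    obtain ⟨z, rfl⟩ := Subgroup.mem_zpowers_iff.1 hz
    obtain ⟨a, ha⟩ := N.surj ⟨k, hk⟩
    obtain ⟨n, rfl | rfl⟩ := z.eq_nat_or_neg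
    · exact ⟨Nat.pair a (Nat.pair n 0), Subtype.ext (by simp [A, B, C, val, ha])⟩
    · exact ⟨Nat.pair a (Nat.pair 0 n), Subtype.ext (by simp [A, B, C, val, ha])⟩
  · exact Primrec₂.natPair.to_comp.comp
      (N.computable_mul.comp (hA.comp .fst) (Computable.iterate (hB.comp .fst)
        (Computable.iterate (hC.comp .fst) (hA.comp .snd) hf') hf))
      (Primrec₂.natPair.to_comp.comp (hadd.comp (hB.comp .fst) (hB.comp .snd))
        (hadd.comp (hC.comp .fst) (hC.comp .snd)))
  · intro x y
    refine Subtype.ext ?_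
    simp only [A, B, C, val, Nat.unpair_pair, N.val_mul, Subgroup.coe_mul, hfi, hfi']
    generalize N.val x.unpair.1 = u
    generalize N.val y.unpair.1 = v
    rw [pow_add, add_comm, pow_add]
    group
  · refine ComputablePred.of_eq (p := fun x => (cond (decide (C x ≤ B x))
      (decide (m ∣ B x - C x) && decide (N.val (N.mul (A x) (P k0 ((B x - C x) / m))) = 1))
      (decide (m ∣ C x - B x) && decide (N.val (A x) = N.val (P k0 ((C x - B x) / m))))) = true)
      (Computable.computablePred ?_) ?_
    · simp only [Bool.decide_eq_true]
      have hand : Computable₂ and := Primrec.and.to_comp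
      refine Computable.cond (hle.comp hC hB) (hand.comp (hdvd.comp (hsub.comp hB hC))
        (N.computablePred_eq_one.decide.comp (N.computable_mul.comp hA
          (hP.comp (.const k0) (hdiv.comp (hsub.comp hB hC))))))
        (hand.comp (hdvd.comp (hsub.comp hC hB)) (N.computablePred_eq.decide.comp (hA.pair
          (hP.comp (.const k0) (hdiv.comp (hsub.comp hC hB))))))
    · intro x
      refine Iff.trans ?_ ((htriv (A x) (B x) (C x)).symm.trans ?_)
      · by_cases h : C x ≤ B x <;> simp [h]
      · rw [Subtype.ext_iff]; rfl

/-- A numbering of a trivial group. -/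
def ofSubsingleton [Subsingleton G] : Numbering G where
  val _ := 1
  surj x := ⟨0, Subsingleton.elim _ _⟩
  mul _ _ := 0
  computable_mul := .const 0
  val_mul _ _ := by simp
  computablePred_eq_one := ⟨fun _ => isTrue rfl, by simpa using Computable.const true⟩

end Numbering

end CompGroup

namespace CompGroup

open Subgroup hiding lowerCentralSeries lowerCentralSeries_succ lowerCentralSeries_antitone
open scoped commutatorElement

/-! ## Finitely generated nilpotent groups -/

section Nilpotent

variable {G : Type*} [Group G]

/-- The elements that commute with all others modulo a normal subgroup. -/
def centerMod (M : Subgroup G) [M.Normal] : Subgroup G :=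
  (center (G ⧸ M)).comap (QuotientGroup.mk' M)

theorem mem_centerMod {M : Subgroup G} [M.Normal] {g : G} :
    g ∈ centerMod M ↔ ∀ x, ⁅g, x⁆ ∈ M := by
  simp only [centerMod, mem_comap, mem_center_iff, QuotientGroup.mk'_apply]
  constructor
  · intro h x
    rw [← QuotientGroup.eq_one_iff, commutatorElement_def]
    simp only [QuotientGroup.mk_mul, QuotientGroup.mk_inv]
    rw [← h x]; group
  · intro h y
    obtain ⟨x, rfl⟩ := QuotientGroup.mk_surjective y
    have := (QuotientGroup.eq_one_iff _).2 (h x)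
    rw [commutatorElement_def] at this
    simp only [QuotientGroup.mk_mul, QuotientGroup.mk_inv] at this
    rw [mul_inv_eq_one, mul_inv_eq_iff_eq_mul] at this
    exact this.symm

/-- An element commuting modulo `M` with generators is central modulo `M`. -/
theorem mem_centerMod_of_closure {M : Subgroup G} [M.Normal] {S : Set G} (hS : closure S = ⊤)
    {g : G} (h : ∀ x ∈ S, ⁅g, x⁆ ∈ M) : g ∈ centerMod M := by
  have hle : closure S ≤ (centralizer {(g : G ⧸ M)}).comap (QuotientGroup.mk' M) := by
    rw [closure_le]
    intro x hx
    simp only [coe_comap, Set.mem_preimage, SetLike.mem_coe, mem_centralizer_singleton_iff,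
      QuotientGroup.mk'_apply]
    have := (QuotientGroup.eq_one_iff _).2 (h x hx)
    rw [commutatorElement_def] at this
    simp only [QuotientGroup.mk_mul, QuotientGroup.mk_inv] at this
    rw [mul_inv_eq_one, mul_inv_eq_iff_eq_mul] at this
    exact this.symm
  rw [mem_centerMod]
  intro x
  have hx := hle (hS ▸ mem_top x)
  simp only [mem_comap, mem_centralizer_singleton_iff, QuotientGroup.mk'_apply] at hx
  rw [← QuotientGroup.eq_one_iff, commutatorElement_def]
  simp only [QuotientGroup.mk_mul, QuotientGroup.mk_inv]
  rw [← hx]; group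

/-- A conjugate of `k` is `⁅k, g⁆⁻¹ * k`, and the commutator lies in `M ≤ K`. -/
theorem normal_of_le_centerMod {M K : Subgroup G} [M.Normal] (hMK : M ≤ K)
    (hK : K ≤ centerMod M) : K.Normal := by
  refine ⟨fun k hk g => ?_⟩
  have h : ⁅k, g⁆⁻¹ * k ∈ K := K.mul_mem (K.inv_mem (hMK (mem_centerMod.1 (hK hk) g))) hk
  have e : ⁅k, g⁆⁻¹ * k = g * k * g⁻¹ := by rw [commutatorElement_def]; group
  rwa [← e]

local notation "γ" => Subgroup.lowerCentralSeries (⊤ : Subgroup G)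

theorem lowerCentralSeries_le_centerMod (i : ℕ) : γ i ≤ centerMod (γ (i + 1)) := fun g hg =>
  mem_centerMod.2 fun x => by
    rw [Subgroup.lowerCentralSeries_succ]; exact commutator_mem_commutator hg (mem_top x)

/-- Inductively, commutators of generators of one factor with generators of `G` generate the next.
The subgroup `M` spanned by them over `γ (i + 2)` is normal because `γ (i + 1)` is central modulo `γ
(i + 2)`. Modulo `M` all of `γ i` is central, hence `γ (i + 1) ≤ M`. -/
theorem exists_finite_generating_lowerCentralSeries [hG : Group.FG G] (i : ℕ) :
    ∃ S : Set G, S.Finite ∧ γ i = γ (i + 1) ⊔ closure S := by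
  obtain ⟨X, hX, hXf⟩ := Group.fg_iff.1 hG
  induction i with
  | zero => exact ⟨X, hXf, by simp [hX]⟩
  | succ i ih =>
    obtain ⟨S, hSf, hS⟩ := ih
    refine ⟨Set.image2 (fun s x => ⁅s, x⁆) S X, hSf.image2 _ hXf, ?_⟩
    set T := Set.image2 (fun s x => ⁅s, x⁆) S X with hT
    set M := γ (i + 2) ⊔ closure T with hM
    have hSi : ∀ s ∈ S, s ∈ γ i := fun s hs => hS ▸ mem_sup_right (subset_closure hs)
    have hMle : M ≤ γ (i + 1) := by
      refine sup_le (Subgroup.lowerCentralSeries_antitone _ (Nat.le_succ _)) ((closure_le _).2 ?_)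
      rintro _ ⟨s, hs, x, hx, rfl⟩
      exact commutator_mem_commutator (hSi s hs) (mem_top x)
    have hMn : M.Normal := normal_of_le_centerMod (M := γ (i + 2)) le_sup_left
      (hMle.trans (lowerCentralSeries_le_centerMod _))
    refine le_antisymm ?_ hMle
    have hc : γ i ≤ centerMod M := by
      rw [hS]
      refine sup_le (fun g hg => ?_) ((closure_le _).2 fun s hs => ?_)
      · exact mem_centerMod.2 fun x =>
          mem_sup_left (mem_centerMod.1 (lowerCentralSeries_le_centerMod _ hg) x)
      · exact mem_centerMod_of_closure hX fun x hx =>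
          mem_sup_right (subset_closure ⟨s, hs, x, hx, rfl⟩)
    rw [Subgroup.lowerCentralSeries_succ, commutator_le]
    exact fun g hg x _ => mem_centerMod.1 (hc hg) x

/-- Induction along a central series with cyclic factors. -/
theorem polycyclic_induction [Group.FG G] [hN : Group.IsNilpotent G] {P : Subgroup G → Prop}
    (hbot : P ⊥) (hstep : ∀ (K : Subgroup G) (t : G), K.Normal → P K → P (K ⊔ zpowers t)) :
    P ⊤ := by
  obtain ⟨c, hc⟩ := Subgroup.nilpotent_iff_lowerCentralSeries.1 hN
  have key : ∀ d ≤ c, P (γ (c - d)) := by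
    intro d
    induction d with
    | zero => intro _; simpa [hc] using hbot
    | succ d ih =>
      intro hd
      have ihd := ih (by omega)
      obtain ⟨i, hi⟩ : ∃ i, c - (d + 1) = i := ⟨_, rfl⟩
      rw [show c - d = i + 1 by omega] at ihd
      rw [hi]
      obtain ⟨S, hSf, hS⟩ := exists_finite_generating_lowerCentralSeries (G := G) i
      -- The generators of the factor are adjoined one at a time. Every intermediate subgroup is
      -- normal because the factor is central.
      have : ∀ T : Set G, T.Finite → T ⊆ γ i → P (γ (i + 1) ⊔ closure T) := by
        intro T hT
        refine Set.Finite.induction_on T hT (fun _ => by simpa using ihd) ?_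
        intro t T _ _ ihT hsub
        have hle : γ (i + 1) ⊔ closure T ≤ γ i := sup_le
          (Subgroup.lowerCentralSeries_antitone _ (Nat.le_succ _))
          ((closure_le _).2 fun x hx => hsub (Set.mem_insert_of_mem _ hx))
        have hn := normal_of_le_centerMod (M := γ (i + 1)) le_sup_left
          (hle.trans (lowerCentralSeries_le_centerMod i))
        have := hstep _ t hn (ihT fun x hx => hsub (Set.mem_insert_of_mem _ hx))
        rwa [sup_assoc, zpowers_eq_closure, ← Subgroup.closure_union, Set.union_singleton] at this
      rw [hS]
      exact this S hSf fun s hs => hS ▸ mem_sup_right (subset_closure hs)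
  simpa using key c le_rfl

theorem fg_sup_zpowers {K : Subgroup G} (hK : K.FG) (t : G) : (K ⊔ zpowers t).FG :=
  hK.sup ⟨{t}, by simp [zpowers_eq_closure]⟩

/-- Finite generation is carried through the induction because the cyclic extension step needs
conjugation on `K` to be computable. -/
theorem nonempty_numbering [Group.FG G] [Group.IsNilpotent G] : Nonempty (Numbering G) := by
  have h : (⊤ : Subgroup G).FG ∧ Nonempty (Numbering (⊤ : Subgroup G)) := by
    refine polycyclic_induction (P := fun K => K.FG ∧ Nonempty (Numbering K))
      ⟨⟨∅, by simp⟩, ⟨Numbering.ofSubsingleton⟩⟩ ?_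
    rintro K t hn ⟨hfg, ⟨N⟩⟩
    have := (Group.fg_iff_subgroup_fg K).2 hfg
    exact ⟨fg_sup_zpowers hfg t, N.sup_zpowers t⟩
  exact h.2.map fun N => N.ofEquiv topEquiv

/-- All subgroups of a finitely generated nilpotent group are finitely generated. -/
theorem fg_of_isNilpotent [Group.FG G] [Group.IsNilpotent G] (H : Subgroup G) : H.FG := by
  have h : ∀ H ≤ (⊤ : Subgroup G), H.FG := by
    refine polycyclic_induction (P := fun K => ∀ H ≤ K, H.FG)
      (fun H hH => ⟨∅, by simp [le_bot_iff.1 hH]⟩) ?_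
    intro K t hn hK H hH
    -- The exponents of `t` occurring in `H` form `mℤ`. One element `k * t ^ m` of `H` realizing the
    -- generator, together with `H ⊓ K`, then generates `H`.
    obtain ⟨m, hm⟩ : ∃ m : ℕ, ∀ z : ℤ, (∃ k ∈ K, k * t ^ z ∈ H) ↔ (m : ℤ) ∣ z := by
      obtain ⟨m, hm⟩ := Numbering.exists_zpow_mem_iff (K ⊔ H ⊓ (K ⊔ zpowers t)) t
      refine ⟨m, fun z => ?_⟩
      rw [← hm, inf_eq_left.2 hH, mem_sup_of_normal_left]
      constructor
      · rintro ⟨k, hk, h⟩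
        exact ⟨k⁻¹, K.inv_mem hk, _, h, by group⟩
      · rintro ⟨k, hk, h, hh, e⟩
        exact ⟨k⁻¹, K.inv_mem hk, by rw [← e]; simpa using hh⟩
    obtain ⟨k, hk, hkH⟩ := (hm m).2 dvd_rfl
    have e : H = (H ⊓ K) ⊔ zpowers (k * t ^ (m : ℤ)) := by
      refine le_antisymm (fun h hh => ?_) (sup_le inf_le_left (by simpa using hkH))
      obtain ⟨k', hk', z, hz, rfl⟩ := mem_sup_of_normal_left.1 (hH hh)
      obtain ⟨z, rfl⟩ := mem_zpowers_iff.1 hz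
      obtain ⟨d, rfl⟩ := (hm z).1 ⟨k', hk', hh⟩
      have hu : (k * t ^ (m : ℤ)) ^ d ∈ zpowers (k * t ^ (m : ℤ)) := zpow_mem (mem_zpowers _) d
      have huH : (k * t ^ (m : ℤ)) ^ d ∈ H := zpow_mem hkH d
      have hq : k' * t ^ ((m : ℤ) * d) * ((k * t ^ (m : ℤ)) ^ d)⁻¹ ∈ K := by
        rw [← QuotientGroup.eq_one_iff]
        have h1 := (QuotientGroup.eq_one_iff k).2 hk
        have h2 := (QuotientGroup.eq_one_iff k').2 hk'
        simp only [QuotientGroup.mk_mul, QuotientGroup.mk_inv, QuotientGroup.mk_zpow]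
        rw [h1, h2, zpow_mul]
        simp
      have := mul_mem (mem_sup_left (T := zpowers (k * t ^ (m : ℤ)))
        (mem_inf.2 ⟨H.mul_mem hh (H.inv_mem huH), hq⟩)) (mem_sup_right (S := H ⊓ K) hu)
      simpa using this
    rw [e]
    exact fg_sup_zpowers (hK _ inf_le_right) _
  exact h H le_top

/-- Finitely generated nilpotent groups are Hopfian. -/
theorem injective_of_surjective [Group.FG G] [Group.IsNilpotent G] (φ : G →* G)
    (hφ : Function.Surjective φ) : Function.Injective φ := by
  -- The kernels of the iterates ascend, and their union is finitely generated, so the chain stops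
  -- at some `k`. An element of `φ.ker` is `φ^[k] y` by surjectivity; then `y ∈ K (k + 1) ≤ K k`, so
  -- the element is trivial.
  let K : ℕ → Subgroup G := fun k => MonoidHom.ker ((show Monoid.End G from φ) ^ k)
  have hmem : ∀ k x, x ∈ K k ↔ φ^[k] x = 1 := fun k x => by
    exact iff_of_eq (congrArg (· = 1) (congrFun (Monoid.End.coe_pow G φ k) x))
  have hmono : Monotone K := monotone_nat_of_le_succ fun k x hx => by
    rw [hmem] at *
    rw [Function.iterate_succ_apply', hx, map_one]
  obtain ⟨S, hS⟩ := fg_of_isNilpotent (⨆ k, K k)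
  have hk : ∃ k, ∀ s ∈ S, s ∈ K k := by
    have hs : ∀ s ∈ S, ∃ k, s ∈ K k := fun s hs =>
      (mem_iSup_of_directed hmono.directed_le).1 (hS ▸ subset_closure hs)
    choose! f hf using hs
    exact ⟨S.sup f, fun s h => hmono (Finset.le_sup h) (hf s h)⟩
  obtain ⟨k, hk⟩ := hk
  have hle : K (k + 1) ≤ K k := by
    refine (le_iSup K (k + 1)).trans ?_
    rw [← hS, closure_le]
    exact hk
  refine (injective_iff_map_eq_one φ).2 fun x hx => ?_
  obtain ⟨y, rfl⟩ := hφ.iterate k x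
  refine (hmem k y).1 (hle ((hmem (k + 1) y).2 ?_))
  rw [Function.iterate_succ_apply', hx]

end Nilpotent

end CompGroup

namespace CompGroup

open Subgroup hiding lowerCentralSeries lowerCentralSeries_succ lowerCentralSeries_antitone

/-! ## Relators and characters -/

section Relators

variable {G : Type*} [Group G]

local notation "γ" => Subgroup.lowerCentralSeries (⊤ : Subgroup G)

/-- Zorn's lemma applies: if the union of a chain contained all of the finitely many generators, a
single member would. -/
theorem exists_coatom_ge [Group.FG G] {K : Subgroup G} (hK : K ≠ ⊤) :
    ∃ M : Subgroup G, IsCoatom M ∧ K ≤ M := by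
  obtain ⟨n, x, hx⟩ := exists_fin_generators G
  obtain ⟨M, hKM, hM⟩ := zorn_le_nonempty₀ {H : Subgroup G | H ≠ ⊤} (fun c hc hch y hy => by
    refine ⟨sSup c, fun h => ?_, fun z hz => le_sSup hz⟩
    have hmem : ∀ j, ∃ H : c, x j ∈ H.1 := fun j => by
      obtain ⟨H, hH, hj⟩ := (mem_sSup_of_directedOn ⟨y, hy⟩ hch.directedOn).1
        (h ▸ mem_top (x j) : x j ∈ sSup c)
      exact ⟨⟨H, hH⟩, hj⟩
    choose f hf using hmem
    have : Nonempty c := ⟨⟨y, hy⟩⟩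
    obtain ⟨z, hz⟩ := hch.directed.finite_le f
    refine hc z.2 (top_le_iff.1 ?_)
    rw [← hx, closure_le]
    rintro _ ⟨j, rfl⟩
    exact hz j (hf j)) K hK
  refine ⟨M, ⟨hM.prop, fun H hH => ?_⟩, hKM⟩
  by_contra h
  exact hH.not_ge (hM.le_of_ge h hH.le)

/-- A proper subgroup of a finitely generated nilpotent group is killed by a nontrivial
homomorphism to a finite cyclic group. -/
theorem exists_character [Group.FG G] [Group.IsNilpotent G] {K : Subgroup G} (hK : K ≠ ⊤) :
    ∃ (m : ℕ) (χ : G →* Multiplicative (ZMod (m + 1))), K ≤ χ.ker ∧ χ ≠ 1 := by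
  -- A maximal subgroup of a nilpotent group is normal, and the quotient, being simple and
  -- nilpotent, is cyclic of prime order.
  obtain ⟨M, hM, hKM⟩ := exists_coatom_ge hK
  have hMn : M.Normal := NormalizerCondition.normal_of_coatom M
    Group.normalizerCondition_of_isNilpotent hM
  have hnt : Nontrivial (G ⧸ M) := QuotientGroup.nontrivial_iff.2 hM.1
  have hsimple : IsSimpleGroup (G ⧸ M) := ⟨fun H _ => by
    have hle : M ≤ H.comap (QuotientGroup.mk' M) := fun x hx => by
      rw [mem_comap, QuotientGroup.mk'_apply, (QuotientGroup.eq_one_iff x).2 hx]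
      exact one_mem _
    rcases hM.le_iff.1 hle with h | h
    · right
      rw [← map_comap_eq_self_of_surjective (QuotientGroup.mk'_surjective M) H, h,
        map_top_of_surjective _ (QuotientGroup.mk'_surjective M)]
    · left
      rw [← map_comap_eq_self_of_surjective (QuotientGroup.mk'_surjective M) H, h,
        QuotientGroup.map_mk'_self]⟩
  obtain ⟨p, hp, ⟨e⟩⟩ := exists_prime_addEquiv_ZMod (G := G ⧸ M)
  have key : ∃ χ : G →* Multiplicative (ZMod p), K ≤ χ.ker ∧ χ ≠ 1 := by
    refine ⟨(AddEquiv.toMultiplicativeRight e).toMonoidHom.comp (QuotientGroup.mk' M), ?_, ?_⟩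
    · intro k hk
      simpa [MonoidHom.mem_ker] using hKM hk
    · intro h
      obtain ⟨y, hy⟩ := exists_ne (1 : G ⧸ M)
      obtain ⟨g, rfl⟩ := QuotientGroup.mk_surjective y
      have := DFunLike.congr_fun h g
      simp at this
      exact hy (by simpa using this)
  obtain ⟨m, rfl⟩ := Nat.exists_eq_succ_of_ne_zero hp.ne_zero
  exact ⟨m, key⟩

theorem lift_finExt_eq {n : ℕ} (x : Fin n → G) (t : GTerm ℕ) :
    FreeGroup.lift x (t.lift (finExt FreeGroup.of 1)) = t.lift (finExt x 1) := by
  rw [GTerm.map_lift]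
  congr 1
  funext i
  rw [apply_finExt (FreeGroup.lift x)]
  simp

theorem exists_term_freeGroup {n : ℕ} (w : FreeGroup (Fin n)) :
    ∃ t : GTerm ℕ, t.lift (finExt FreeGroup.of 1) = w :=
  GTerm.exists_lift_eq_of_mem_closure (by
    rw [closure_range_finExt, FreeGroup.closure_range_of]; trivial)

theorem freeGroup_lift_surjective {n : ℕ} {x : Fin n → G} (hx : closure (Set.range x) = ⊤) :
    Function.Surjective (FreeGroup.lift x) := by
  rw [← MonoidHom.range_eq_top, FreeGroup.range_lift_eq_closure, hx]

/-- A finite list of relators presents a group relative to a class of nilpotency. -/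
def IsRelatorList {n : ℕ} (c : ℕ) (x : Fin n → G) (rel : List (GTerm ℕ)) : Prop :=
  (∀ r ∈ rel, r.lift (finExt x 1) = 1) ∧
    ∀ w, FreeGroup.lift x w = 1 →
      w ∈ closure {v | ∃ r ∈ rel, r.lift (finExt FreeGroup.of 1) = v} ⊔
        Subgroup.lowerCentralSeries (⊤ : Subgroup (FreeGroup (Fin n))) c

/-- The free group modulo a term of its lower central series is finitely generated nilpotent, so the
image of the relation subgroup there is finitely generated. Lifts of its generators serve as
relators, and no normal closure is needed. -/
theorem exists_isRelatorList {n : ℕ} (c : ℕ) (x : Fin n → G) :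
    ∃ rel, IsRelatorList c x rel := by
  classical
  let L := Subgroup.lowerCentralSeries (⊤ : Subgroup (FreeGroup (Fin n))) c
  let q := QuotientGroup.mk' L
  have hnil : Group.IsNilpotent (FreeGroup (Fin n) ⧸ L) := by
    refine Subgroup.nilpotent_iff_lowerCentralSeries.2 ⟨c, ?_⟩
    have h := Subgroup.map_lowerCentralSeries (⊤ : Subgroup (FreeGroup (Fin n))) q c
    rw [map_top_of_surjective _ (QuotientGroup.mk'_surjective L)] at h
    rw [← h]
    exact QuotientGroup.map_mk'_self L
  obtain ⟨S, hS⟩ := fg_of_isNilpotent ((FreeGroup.lift x).ker.map q)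
  have hmem : ∀ s ∈ S, ∃ t : GTerm ℕ, t.lift (finExt x 1) = 1 ∧
      q (t.lift (finExt FreeGroup.of 1)) = s := fun s hs => by
    obtain ⟨w, hw, rfl⟩ : s ∈ (FreeGroup.lift x).ker.map q := hS ▸ subset_closure hs
    obtain ⟨t, rfl⟩ := exists_term_freeGroup w
    exact ⟨t, by rw [← lift_finExt_eq]; exact hw, rfl⟩
  have : Nonempty (GTerm ℕ) := ⟨.one⟩
  choose! f hf using hmem
  refine ⟨S.toList.map f, ?_, fun w hw => ?_⟩
  · simp only [List.mem_map, Finset.mem_toList]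
    rintro r ⟨s, hs, rfl⟩
    exact (hf s hs).1
  · have h1 : q w ∈ closure (S : Set (FreeGroup (Fin n) ⧸ L)) := hS ▸ mem_map_of_mem q hw
    have h2 : closure (S : Set (FreeGroup (Fin n) ⧸ L)) ≤ (closure {v | ∃ r ∈ S.toList.map f,
        r.lift (finExt FreeGroup.of 1) = v}).map q := by
      rw [closure_le]
      intro s hs
      exact ⟨_, subset_closure ⟨f s, List.mem_map.2 ⟨s, by simpa using hs, rfl⟩, rfl⟩, (hf s hs).2⟩
    have h3 := mem_comap.2 (h2 h1)
    rwa [comap_map_eq, QuotientGroup.ker_mk'] at h3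

/-- A group hom defined on generators. -/
theorem exists_hom_of_ker_le {H : Type*} [Group H] {n : ℕ} {x : Fin n → G}
    (hx : closure (Set.range x) = ⊤) (y : Fin n → H)
    (h : (FreeGroup.lift x).ker ≤ (FreeGroup.lift y).ker) : ∃ φ : G →* H, ∀ j, φ (x j) = y j := by
  refine ⟨(FreeGroup.lift x).liftOfSurjective (freeGroup_lift_surjective hx)
    ⟨FreeGroup.lift y, h⟩, fun j => ?_⟩
  have := (FreeGroup.lift x).liftOfRightInverse_comp_apply _
    (Function.rightInverse_surjInv (freeGroup_lift_surjective hx)) ⟨FreeGroup.lift y, h⟩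
    (FreeGroup.of j)
  simpa using this

/-- The map from the free group to `H` kills the relators by assumption and the `c`-th lower central
term by nilpotency of `H`, hence every relation of `x`. -/
theorem IsRelatorList.exists_hom {H : Type*} [Group H] {n c : ℕ} {x : Fin n → G}
    {rel : List (GTerm ℕ)} (hrel : IsRelatorList c x rel) (hx : closure (Set.range x) = ⊤)
    (hH : Subgroup.lowerCentralSeries (⊤ : Subgroup H) c = ⊥) {y : Fin n → H}
    (hy : ∀ r ∈ rel, r.lift (finExt y 1) = 1) : ∃ φ : G →* H, ∀ j, φ (x j) = y j := by
  refine exists_hom_of_ker_le hx y fun w hw => ?_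
  have h1 : closure {v | ∃ r ∈ rel, r.lift (finExt FreeGroup.of 1) = v} ≤
      (FreeGroup.lift y).ker := by
    rw [closure_le]
    rintro _ ⟨r, hr, rfl⟩
    change FreeGroup.lift y _ = 1
    rw [lift_finExt_eq]; exact hy r hr
  have h2 : Subgroup.lowerCentralSeries (⊤ : Subgroup (FreeGroup (Fin n))) c ≤
      (FreeGroup.lift y).ker := by
    rw [← Subgroup.map_eq_bot_iff, eq_bot_iff, ← hH]
    rw [Subgroup.map_lowerCentralSeries]
    exact Subgroup.lowerCentralSeries_mono c le_top
  exact sup_le h1 h2 (hrel.2 w hw)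

theorem hom_lift_finExt {H : Type*} [Group H] {n : ℕ} {x : Fin n → G} {y : Fin n → H} {φ : G →* H}
    (h : ∀ j, φ (x j) = y j) (t : GTerm ℕ) : φ (t.lift (finExt x 1)) = t.lift (finExt y 1) := by
  rw [GTerm.map_lift]
  congr 1
  funext i
  rw [apply_finExt φ, map_one]
  simp only [h]

theorem hom_eq_of_generators {H : Type*} [Group H] {n : ℕ} {x : Fin n → G}
    (hx : closure (Set.range x) = ⊤) {φ ψ : G →* H} (h : ∀ j, φ (x j) = ψ (x j)) : φ = ψ :=
  MonoidHom.eq_of_eqOn_dense hx (by rintro _ ⟨j, rfl⟩; exact h j)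

/-- The value of a term in the cyclic group of order `m + 1` under an assignment. -/
def charVal {n : ℕ} (m : ℕ) (a : Fin n → ℕ) (t : GTerm ℕ) : Multiplicative (ZMod (m + 1)) :=
  t.lift (finExt (fun j => Multiplicative.ofAdd (a j : ZMod (m + 1))) 1)

/-- The numbers `a` define a nontrivial homomorphism to the cyclic group of order `m + 1` that
kills the terms `w`. -/
def IsCharCert {n : ℕ} (rel : List (GTerm ℕ)) (m : ℕ) (a : Fin n → ℕ) (w : Fin n → GTerm ℕ) :
    Prop :=
  (∀ r ∈ rel, charVal m a r = 1) ∧ (∀ j, charVal m a (w j) = 1) ∧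
    ∃ j, (a j : ZMod (m + 1)) ≠ 0

/-- The universal part of the description of generating tuples in `G`. -/
def IsGoodTuple {n : ℕ} (x : Fin n → G) (rel : List (GTerm ℕ)) {H : Type*} [Group H]
    (g : Fin n → H) : Prop :=
  (∀ t : GTerm ℕ, t.lift (finExt g 1) = 1 ↔ t.lift (finExt x 1) = 1) ∧
    ∀ (y : Fin n → H) (w : Fin n → GTerm ℕ) (m : ℕ) (a : Fin n → ℕ),
      ¬ ((∀ r ∈ rel, r.lift (finExt y 1) = 1) ∧ IsCharCert rel m a w ∧
        ∀ j, g j = (w j).lift (finExt y 1))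

theorem lowerCentralSeries_comm {H : Type*} [CommGroup H] {c : ℕ} (hc : 1 ≤ c) :
    Subgroup.lowerCentralSeries (⊤ : Subgroup H) c = ⊥ := by
  obtain ⟨d, rfl⟩ := Nat.exists_eq_add_of_le' hc
  rw [Subgroup.lowerCentralSeries_succ, eq_bot_iff, commutator_le]
  intro a _ b _
  rw [mem_bot, commutatorElement_eq_one_iff_mul_comm, mul_comm]

/-- The target is abelian, so for `1 ≤ c` the relator criterion applies to it as well: a certificate
is a finite object that encodes a genuine character of `G`. -/
theorem exists_hom_of_isCharCert {n c : ℕ} {x : Fin n → G} {rel : List (GTerm ℕ)}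
    (hc : 1 ≤ c) (hrel : IsRelatorList c x rel) (hx : closure (Set.range x) = ⊤) {m : ℕ}
    {a : Fin n → ℕ} {w : Fin n → GTerm ℕ} (h : IsCharCert rel m a w) :
    ∃ χ : G →* Multiplicative (ZMod (m + 1)), χ ≠ 1 ∧
      closure (Set.range fun j => (w j).lift (finExt x 1)) ≤ χ.ker := by
  obtain ⟨χ, hχ⟩ := hrel.exists_hom hx (lowerCentralSeries_comm hc) h.1
  refine ⟨χ, ?_, (closure_le _).2 ?_⟩
  · rintro rfl
    obtain ⟨j, hj⟩ := h.2.2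
    exact hj (Multiplicative.ofAdd.injective (hχ j).symm)
  · rintro _ ⟨j, rfl⟩
    exact (hom_lift_finExt hχ _).trans (h.2.1 j)

/-- A violation gives an endomorphism `φ` mapping the subgroup generated by the `w j`, which lies in
the kernel of a nontrivial character, onto `G`. By the Hopf property `φ` is injective, so that
subgroup is all of `G` and the character is trivial. -/
theorem isGoodTuple_generators [Group.FG G] [Group.IsNilpotent G] {n c : ℕ} {x : Fin n → G}
    {rel : List (GTerm ℕ)} (hc : 1 ≤ c) (hG : γ c = ⊥) (hrel : IsRelatorList c x rel)
    (hx : closure (Set.range x) = ⊤) : IsGoodTuple x rel x := by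
  refine ⟨fun t => Iff.rfl, fun y w m a ⟨hy, hcert, hg⟩ => ?_⟩
  obtain ⟨χ, hχ, hker⟩ := exists_hom_of_isCharCert hc hrel hx hcert
  obtain ⟨φ, hφ⟩ := hrel.exists_hom hx hG hy
  have hmap : (closure (Set.range fun j => (w j).lift (finExt x 1))).map φ = ⊤ := by
    rw [eq_top_iff, ← hx, closure_le]
    rintro _ ⟨j, rfl⟩
    exact ⟨_, subset_closure ⟨j, rfl⟩, (hom_lift_finExt hφ _).trans (hg j).symm⟩
  have hsurj : Function.Surjective φ := fun z => by
    obtain ⟨u, -, hu⟩ : z ∈ (closure (Set.range fun j => (w j).lift (finExt x 1))).map φ :=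
      hmap ▸ mem_top z
    exact ⟨u, hu⟩
  have hinj := injective_of_surjective φ hsurj
  apply hχ
  ext1 z
  obtain ⟨u, hu, hz⟩ : φ z ∈ (closure (Set.range fun j => (w j).lift (finExt x 1))).map φ :=
    hmap ▸ mem_top _
  rw [← hinj hz]
  exact hker hu

/-- If `g` generated a proper subgroup, a character killing it would violate goodness with `y = x`,
that is, with the identity endomorphism. -/
theorem closure_eq_top_of_isGoodTuple [Group.FG G] [Group.IsNilpotent G] {n c : ℕ} {x : Fin n → G}
    {rel : List (GTerm ℕ)} (hrel : IsRelatorList c x rel)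
    (hx : closure (Set.range x) = ⊤) {g : Fin n → G} (hg : IsGoodTuple x rel g) :
    closure (Set.range g) = ⊤ := by
  by_contra hne
  obtain ⟨m, χ, hker, hχ⟩ := exists_character hne
  have hterm : ∀ j, ∃ t : GTerm ℕ, t.lift (finExt x 1) = g j := fun j =>
    GTerm.exists_lift_eq_of_mem_closure (by rw [closure_range_finExt, hx]; trivial)
  choose w hw using hterm
  have hval : ∀ t, charVal m (fun j => (Multiplicative.toAdd (χ (x j))).val) t =
      χ (t.lift (finExt x 1)) := fun t => by
    rw [hom_lift_finExt (y := fun j => χ (x j)) fun j => rfl, charVal]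
    congr 2
    funext j
    rw [ZMod.natCast_zmod_val]; rfl
  refine hg.2 x w m (fun j => (Multiplicative.toAdd (χ (x j))).val)
    ⟨hrel.1, ⟨fun r hr => ?_, fun j => ?_, ?_⟩, fun j => (hw j).symm⟩
  · rw [hval, hrel.1 r hr, map_one]
  · rw [hval, hw]
    exact hker (subset_closure ⟨j, rfl⟩)
  · by_contra! hall
    refine hχ (hom_eq_of_generators hx fun j => ?_)
    have := hall j
    rw [ZMod.natCast_zmod_val] at this
    exact Multiplicative.toAdd.injective this

/-- Groups with a good tuple in which all good tuples generate are isomorphic to `G`. -/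
theorem nonempty_mulEquiv_of_isGoodTuple {n : ℕ} {x : Fin n → G} {rel : List (GTerm ℕ)}
    (hx : closure (Set.range x) = ⊤) {H : Type*} [Group H] {g : Fin n → H}
    (hg : IsGoodTuple x rel g) (hgen : closure (Set.range g) = ⊤) : Nonempty (H ≃* G) := by
  have hker : (FreeGroup.lift x).ker = (FreeGroup.lift g).ker := by
    ext w
    obtain ⟨t, rfl⟩ := exists_term_freeGroup w
    rw [MonoidHom.mem_ker, MonoidHom.mem_ker, lift_finExt_eq, lift_finExt_eq, hg.1]
  obtain ⟨φ, hφ⟩ := exists_hom_of_ker_le hx g hker.le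
  obtain ⟨ψ, hψ⟩ := exists_hom_of_ker_le hgen x hker.ge
  exact ⟨ψ.toMulEquiv φ (hom_eq_of_generators hgen fun j => by simp [hφ, hψ])
    (hom_eq_of_generators hx fun j => by simp [hφ, hψ])⟩

theorem IsGoodTuple.map {n : ℕ} {x : Fin n → G} {rel : List (GTerm ℕ)} {H H' : Type*} [Group H]
    [Group H'] {g : Fin n → H} (hg : IsGoodTuple x rel g) (e : H ≃* H') :
    IsGoodTuple x rel fun j => e (g j) := by
  have hl : ∀ (y : Fin n → H) (t : GTerm ℕ),
      t.lift (finExt (fun j => e (y j)) 1) = e (t.lift (finExt y 1)) := fun y t =>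
    (hom_lift_finExt (φ := e.toMonoidHom) (fun j => rfl) t).symm
  refine ⟨fun t => ?_, fun y w m a ⟨hy, hcert, hgw⟩ => ?_⟩
  · rw [hl, map_eq_one_iff e e.injective, hg.1]
  · have hl' : ∀ t : GTerm ℕ, t.lift (finExt y 1) = e (t.lift (finExt (fun j => e.symm (y j)) 1)) :=
      fun t => by rw [← hl]; simp
    refine hg.2 (fun j => e.symm (y j)) w m a ⟨fun r hr => ?_, hcert, fun j => ?_⟩
    · rw [← map_eq_one_iff e e.injective, ← hl', hy r hr]
    · rw [← e.injective.eq_iff, ← hl']; exact hgw j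

/-- A characterization of the isomorphism type of a finitely generated nilpotent group. -/
theorem nonempty_mulEquiv_iff [Group.FG G] [Group.IsNilpotent G] {n c : ℕ} {x : Fin n → G}
    {rel : List (GTerm ℕ)} (hc : 1 ≤ c) (hG : γ c = ⊥) (hrel : IsRelatorList c x rel)
    (hx : closure (Set.range x) = ⊤) (H : Type*) [Group H] :
    Nonempty (H ≃* G) ↔ (∃ g : Fin n → H, IsGoodTuple x rel g) ∧
      ∀ g : Fin n → H, IsGoodTuple x rel g → ∀ z, ∃ t : GTerm ℕ, t.lift (finExt g 1) = z := by
  constructor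
  · rintro ⟨e⟩
    refine ⟨⟨_, (isGoodTuple_generators hc hG hrel hx).map e.symm⟩, fun g hg z => ?_⟩
    have h1 := closure_eq_top_of_isGoodTuple hrel hx (hg.map e)
    obtain ⟨t, ht⟩ := GTerm.exists_lift_eq_of_mem_closure
      (f := finExt (fun j => e (g j)) 1) (x := e z) (by rw [closure_range_finExt, h1]; trivial)
    refine ⟨t, e.injective ?_⟩
    rw [← ht]
    exact hom_lift_finExt (φ := e.toMonoidHom) (fun j => rfl) t
  · rintro ⟨⟨g, hg⟩, h⟩
    refine nonempty_mulEquiv_of_isGoodTuple hx hg (eq_top_iff.2 fun z _ => ?_)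
    obtain ⟨t, rfl⟩ := h g hg z
    rw [← closure_range_finExt]
    exact t.lift_mem fun i => subset_closure (Set.mem_range_self i)

end Relators

end CompGroup

namespace CompGroup

/-! ## Atomic diagrams and terms over `ℕ` -/

/-- A term over a set of numbers as a term over `ℕ`. -/
def GTerm.incl {U : Set ℕ} (t : GTerm U) : GTerm ℕ := t.bind fun a : U => .const (a : ℕ)

@[simp] theorem GTerm.incl_const {U : Set ℕ} (a : U) : (const a).incl = const (a : ℕ) := rfl
@[simp] theorem GTerm.incl_one {U : Set ℕ} : (one : GTerm U).incl = one := rfl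
@[simp] theorem GTerm.incl_inv {U : Set ℕ} (t : GTerm U) : (inv t).incl = inv t.incl := rfl
@[simp] theorem GTerm.incl_mul {U : Set ℕ} (t s : GTerm U) :
    (mul t s).incl = mul t.incl s.incl := rfl

theorem GTerm.incl_injective {U : Set ℕ} : Function.Injective (GTerm.incl (U := U)) := by
  intro t
  induction t with
  | const a => intro s h; cases s <;> simp_all [Subtype.ext_iff]
  | one => intro s h; cases s <;> simp_all
  | inv t ih => intro s h; cases s <;> simp at h; exact congrArg inv (ih h)
  | mul t t' ih ih' => intro s h; cases s <;> simp at h; exact congrArg₂ mul (ih h.1) (ih' h.2)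

theorem GTerm.code_eq {U : Set ℕ} (t : GTerm U) : t.code = t.incl.toNat := by
  induction t with
  | const a => rfl
  | one => rfl
  | inv t ih => rw [code, ih]; rfl
  | mul t s iht ihs => rw [code, iht, ihs]; rfl

/-- All constants of a term satisfy a decidable property. -/
def GTerm.allConst {A : Type} (p : A → Bool) (t : GTerm A) : Bool :=
  t.fold p true id fun q => q.1 && q.2

theorem GTerm.allConst_iff {U : Set ℕ} {p : ℕ → Bool} (hp : ∀ a, p a = true ↔ a ∈ U)
    (t : GTerm ℕ) : t.allConst p = true ↔ ∃ t' : GTerm U, t'.incl = t := by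
  induction t with
  | const a =>
    refine (hp a).trans ⟨fun h => ⟨const ⟨a, h⟩, rfl⟩, ?_⟩
    rintro ⟨t', h⟩
    cases t' <;> simp at h
    exact h ▸ Subtype.prop _
  | one => exact ⟨fun _ => ⟨one, rfl⟩, fun _ => rfl⟩
  | inv t ih =>
    refine Iff.trans ih ⟨fun ⟨t', h⟩ => ⟨inv t', by simp [h]⟩, ?_⟩
    rintro ⟨t', h⟩
    cases t' <;> simp at h
    exact ⟨_, h⟩
  | mul t s iht ihs =>
    refine Iff.trans (Bool.and_eq_true_iff.trans (and_congr iht ihs))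
      ⟨fun ⟨⟨t', h⟩, ⟨s', h'⟩⟩ => ⟨mul t' s', by simp [h, h']⟩, ?_⟩
    rintro ⟨t', h⟩
    cases t' <;> simp at h
    exact ⟨⟨_, h.1⟩, ⟨_, h.2⟩⟩

/-- The code of an equation between terms over `ℕ`. -/
def eqCode (t s : GTerm ℕ) : ℕ := 2 * Nat.pair t.toNat s.toNat

/-! ### Membership of equations and inequations in a diagram. -/

section Diagram

variable {U : Set ℕ} [Group U]

theorem eqCode_mem_iff {t s : GTerm ℕ} : eqCode t s ∈ atomicDiagram U ↔
    ∃ t' s' : GTerm U, t'.incl = t ∧ s'.incl = s ∧ t'.eval = s'.eval := by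
  constructor
  · rintro ⟨t', s', ⟨h, he⟩ | ⟨h, -⟩⟩
    · have h' : Nat.pair t.toNat s.toNat = Nat.pair t'.code s'.code := by
        simp only [eqCode, codeEq] at h; omega
      rw [Nat.pair_eq_pair, GTerm.code_eq, GTerm.code_eq] at h'
      exact ⟨t', s', GTerm.equivNat.injective h'.1.symm, GTerm.equivNat.injective h'.2.symm, he⟩
    · simp only [eqCode, codeNe] at h; omega
  · rintro ⟨t', s', rfl, rfl, he⟩
    exact ⟨t', s', Or.inl ⟨by rw [codeEq, t'.code_eq, s'.code_eq]; rfl, he⟩⟩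

theorem eqCode_succ_mem_iff {t s : GTerm ℕ} : eqCode t s + 1 ∈ atomicDiagram U ↔
    ∃ t' s' : GTerm U, t'.incl = t ∧ s'.incl = s ∧ t'.eval ≠ s'.eval := by
  constructor
  · rintro ⟨t', s', ⟨h, -⟩ | ⟨h, he⟩⟩
    · simp only [eqCode, codeEq] at h; omega
    · have h' : Nat.pair t.toNat s.toNat = Nat.pair t'.code s'.code := by
        simp only [eqCode, codeNe] at h; omega
      rw [Nat.pair_eq_pair, GTerm.code_eq, GTerm.code_eq] at h'
      exact ⟨t', s', GTerm.equivNat.injective h'.1.symm, GTerm.equivNat.injective h'.2.symm, he⟩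
  · rintro ⟨t', s', rfl, rfl, he⟩
    exact ⟨t', s', Or.inr ⟨by rw [codeNe, t'.code_eq, s'.code_eq]; rfl, he⟩⟩

theorem eqCode_incl_mem_iff {t s : GTerm U} :
    eqCode t.incl s.incl ∈ atomicDiagram U ↔ t.eval = s.eval := by
  rw [eqCode_mem_iff]
  constructor
  · rintro ⟨t', s', h, h', he⟩
    rwa [GTerm.incl_injective h, GTerm.incl_injective h'] at he
  · exact fun h => ⟨t, s, rfl, rfl, h⟩

theorem exists_eqCode (x : ℕ) : ∃ t s : GTerm ℕ, x = eqCode t s ∨ x = eqCode t s + 1 := by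
  refine ⟨GTerm.ofNat (x / 2).unpair.1, GTerm.ofNat (x / 2).unpair.2, ?_⟩
  simp only [eqCode, GTerm.toNat_ofNat, Nat.pair_unpair]
  omega

theorem mem_universe_iff {a : ℕ} :
    eqCode (.const a) (.const a) ∈ atomicDiagram U ↔ a ∈ U := by
  rw [eqCode_mem_iff]
  constructor
  · rintro ⟨t', s', h, -, -⟩
    cases t' <;> simp at h
    exact h ▸ Subtype.prop _
  · exact fun h => ⟨.const ⟨a, h⟩, .const ⟨a, h⟩, rfl, rfl, rfl⟩

end Diagram

/-- The sentences `a = a` determine the universe and the sentences `a * b = c` determine the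
multiplication. -/
theorem nonempty_mulEquiv_of_atomicDiagram_eq {U U' : Set ℕ} [G : Group U] [G' : Group U']
    (h : atomicDiagram U = atomicDiagram U') : Nonempty (U ≃* U') := by
  have hU : U = U' := by
    ext a
    rw [← mem_universe_iff (U := U), h, mem_universe_iff]
  subst hU
  refine ⟨@MulEquiv.mk _ _ G.toMul G'.toMul (Equiv.refl U) fun a b => ?_⟩
  have h1 := (@eqCode_incl_mem_iff U G (.mul (.const a) (.const b)) (.const (@HMul.hMul _ _ _
    (@instHMul _ G.toMul) a b))).2 rfl
  rw [h] at h1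
  exact ((@eqCode_incl_mem_iff U G' _ _).1 h1).symm

theorem IsCharFun.unique {f : ℕ →. ℕ} {D D' : Set ℕ} (h : IsCharFun f D) (h' : IsCharFun f D') :
    D = D' := by
  ext x
  by_cases hx : x ∈ D <;> by_cases hx' : x ∈ D' <;> simp only [hx, hx']
  · have := ((h x).1 hx).symm.trans ((h' x).2 hx')
    simp at this
  · have := ((h x).2 hx).symm.trans ((h' x).1 hx')
    simp at this

/-! ## Uniformly computable copies -/

/-- Uniformly enumerated subgroups of a numbered group have uniformly computable diagrams. -/
theorem Numbering.exists_diagram {L : Type*} [Group L] (N : Numbering L) {r : ℕ → ℕ → ℕ}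
    (hr : Computable₂ r) {H : ℕ → Subgroup L}
    (hH : ∀ n z, z ∈ H n ↔ ∃ a, N.val (r n a) = z) :
    ∃ d : ℕ → ℕ → Bool, Computable₂ d ∧ ∀ n, ∃ (U : Set ℕ) (_ : Group U),
      Nonempty (U ≃* H n) ∧ ∀ x, d n x = true ↔ x ∈ atomicDiagram U := by
  classical
  have hex : ∀ p : ℕ × ℕ, ∃ b, N.val (r p.1 b) = N.val (r p.1 p.2) := fun p => ⟨p.2, rfl⟩
  have hfind := Computable.find (P := fun (p : ℕ × ℕ) b => N.val (r p.1 b) = N.val (r p.1 p.2))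
    (Computable.computablePred (N.computablePred_eq.decide.comp
      ((hr.comp (Computable.fst.comp .fst) .snd).pair
        (hr.comp (Computable.fst.comp .fst) (Computable.snd.comp .fst))))) hex
  -- The universe keeps only the least index of each element, so every element of `H n` is named
  -- exactly once.
  let p : ℕ → ℕ → Bool := fun n a => decide (Nat.find (hex (n, a)) = a)
  have hp : Computable₂ p := (Primrec.eq (α := ℕ)).decide.to_comp.comp hfind .snd
  obtain ⟨F, hF, hFv⟩ := N.exists_term_value hr
  have hok : Computable₂ fun n (t : GTerm ℕ) => t.allConst (p n) :=
    GTerm.computable_fold (i := fun _ b => b) (m := fun _ q => q.1 && q.2) hp (.const true) .snd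
      (Primrec.and.to_comp.comp (Computable.fst.comp .snd) (Computable.snd.comp .snd))
  let T : ℕ → GTerm ℕ := fun x => GTerm.ofNat x.div2.unpair.1
  let S : ℕ → GTerm ℕ := fun x => GTerm.ofNat x.div2.unpair.2
  have hT : Computable T := GTerm.computable_ofNat.comp
    (Computable.fst.comp (Computable.unpair.comp .nat_div2))
  have hS : Computable S := GTerm.computable_ofNat.comp
    (Computable.snd.comp (Computable.unpair.comp .nat_div2))
  let E : ℕ → ℕ → Bool := fun n x => decide (N.val (F n (T x)) = N.val (F n (S x)))
  have hE : Computable₂ E := N.computablePred_eq.decide.comp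
    ((hF.comp .fst (hT.comp .snd)).pair (hF.comp .fst (hS.comp .snd)))
  have hand : Computable₂ and := Primrec.and.to_comp
  refine ⟨fun n x => ((T x).allConst (p n) && (S x).allConst (p n)) &&
    cond x.bodd (!E n x) (E n x), ?_, fun n => ?_⟩
  · exact hand.comp (hand.comp (hok.comp .fst (hT.comp .snd)) (hok.comp .fst (hS.comp .snd)))
      (Computable.cond (Computable.nat_bodd.comp .snd) (Primrec.not.to_comp.comp hE) hE)
  let U : Set ℕ := {a | p n a = true}
  have hinj : ∀ a b : U, N.val (r n a) = N.val (r n b) → a = b := fun a b h => by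
    have ha : Nat.find (hex (n, a)) = a := of_decide_eq_true a.2
    have hb : Nat.find (hex (n, b)) = b := of_decide_eq_true b.2
    refine Subtype.ext (le_antisymm ?_ ?_)
    · rw [← ha]; exact Nat.find_min' (hex (n, a)) h.symm
    · rw [← hb]; exact Nat.find_min' (hex (n, b)) h
  have hmem : ∀ a, N.val (r n a) ∈ H n := fun a => (hH n _).2 ⟨a, rfl⟩
  let e : U ≃ H n := Equiv.ofBijective (fun a => ⟨N.val (r n a), hmem a⟩)
    ⟨fun a b h => hinj a b (congrArg Subtype.val h), fun ⟨z, hz⟩ => by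
      obtain ⟨a, rfl⟩ := (hH n z).1 hz
      have h1 : N.val (r n (Nat.find (hex (n, a)))) = N.val (r n a) := Nat.find_spec (hex (n, a))
      refine ⟨⟨Nat.find (hex (n, a)), decide_eq_true (le_antisymm
        (Nat.find_min' _ rfl) (Nat.find_min' _ ?_))⟩, Subtype.ext h1⟩
      exact (Nat.find_spec (hex (n, Nat.find (hex (n, a))))).trans h1⟩
  let _ : Group U := e.group
  let e' : U ≃* H n := e.mulEquiv
  refine ⟨U, inferInstance, ⟨e'⟩, fun x => ?_⟩
  have hval : ∀ t : GTerm U, ((e' t.eval : H n) : L) = N.val (F n t.incl) := fun t => by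
    rw [hFv, GTerm.incl, GTerm.lift_bind, GTerm.eval_eq_lift]
    exact GTerm.map_lift ((H n).subtype.comp e'.toMonoidHom) _ t
  have hev : ∀ t s : GTerm U, N.val (F n t.incl) = N.val (F n s.incl) ↔ t.eval = s.eval :=
    fun t s => by rw [← hval, ← hval, Subtype.coe_inj, e'.injective.eq_iff]
  obtain ⟨t, s, hx⟩ := exists_eqCode x
  have hTS : T x = t ∧ S x = s := by
    have : x.div2 = Nat.pair t.toNat s.toNat := by
      rw [Nat.div2_val]; rcases hx with rfl | rfl <;> simp only [eqCode] <;> omega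
    simp [T, S, this, GTerm.ofNat_toNat]
  simp only [E, hTS.1, hTS.2, Bool.and_eq_true]
  rw [GTerm.allConst_iff (U := U) (fun a => Iff.rfl), GTerm.allConst_iff (U := U) (fun a => Iff.rfl)]
  rcases hx with rfl | rfl
  · have hb : (eqCode t s).bodd = false := by simp [eqCode]
    rw [hb, eqCode_mem_iff, cond_false, decide_eq_true_iff]
    constructor
    · rintro ⟨⟨⟨t', rfl⟩, ⟨s', rfl⟩⟩, h⟩
      exact ⟨t', s', rfl, rfl, (hev _ _).1 h⟩
    · rintro ⟨t', s', rfl, rfl, h⟩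
      exact ⟨⟨⟨t', rfl⟩, ⟨s', rfl⟩⟩, (hev _ _).2 h⟩
  · have hb : (eqCode t s + 1).bodd = true := by simp [eqCode]
    rw [hb, eqCode_succ_mem_iff, cond_true, Bool.not_eq_true', decide_eq_false_iff_not]
    constructor
    · rintro ⟨⟨⟨t', rfl⟩, ⟨s', rfl⟩⟩, h⟩
      exact ⟨t', s', rfl, rfl, fun h' => h ((hev _ _).2 h')⟩
    · rintro ⟨t', s', rfl, rfl, h⟩
      exact ⟨⟨⟨t', rfl⟩, ⟨s', rfl⟩⟩, fun h' => h ((hev _ _).1 h')⟩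

/-- At input `x` the program first searches for `b` with `R (n, x, b)`, and outputs `d n x` only
after finding one; currying supplies the index. -/
theorem exists_index {d : ℕ → ℕ → Bool} (hd : Computable₂ d) {R : ℕ × ℕ × ℕ → Prop}
    (hR : ComputablePred R) : ∃ f : ℕ → ℕ, Computable f ∧ ∀ n x,
      ((∃ b, R (n, x, b)) → phi (f n) x = Part.some (d n x).toNat) ∧
      ((∀ b, ¬ R (n, x, b)) → phi (f n) x = Part.none) := by
  classical
  let F : ℕ →. ℕ := fun k => (Nat.rfind fun b =>
    Part.some (decide (R (k.unpair.1, k.unpair.2, b)))).map fun _ =>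
      (d k.unpair.1 k.unpair.2).toNat
  have hF : Partrec F := by
    refine Partrec.map (Partrec.rfind (Computable.partrec (hR.decide.comp
      ((Computable.fst.comp (Computable.unpair.comp .fst)).pair
        ((Computable.snd.comp (Computable.unpair.comp .fst)).pair .snd))))) ?_
    refine (Computable.cond (hd.comp (Computable.fst.comp (Computable.unpair.comp .fst))
      (Computable.snd.comp (Computable.unpair.comp .fst))) (.const 1) (.const 0)).of_eq ?_
    intro k
    dsimp only
    cases d k.1.unpair.1 k.1.unpair.2 <;> rfl
  obtain ⟨c, hc⟩ := Nat.Partrec.Code.exists_code.1 (Partrec.nat_iff.1 hF)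
  refine ⟨fun n => Encodable.encode (c.curry n), Computable.encode.comp
    (Nat.Partrec.Code.primrec₂_curry.to_comp.comp (.const c) .id), fun n x => ?_⟩
  have hphi : phi (Encodable.encode (c.curry n)) x = F (Nat.pair n x) := by
    rw [phi, Denumerable.ofNat_encode, Nat.Partrec.Code.eval_curry, hc]
  rw [hphi]
  simp only [F, Nat.unpair_pair]
  constructor
  · rintro ⟨b, hb⟩
    obtain ⟨k, hk, -⟩ := Nat.rfind_min' (p := fun b => decide (R (n, x, b))) (decide_eq_true hb)
    refine Part.eq_some_iff.2 (Part.mem_map_iff _ |>.2 ⟨k, hk, rfl⟩)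
  · intro hb
    refine Part.eq_none_iff.2 fun y hy => ?_
    obtain ⟨k, hk, -⟩ := (Part.mem_map_iff _).1 hy
    have := Nat.rfind_spec hk
    simp at this
    exact hb k this

/-- The reduction behind the hardness results. -/
theorem Numbering.exists_reduction {L G : Type*} [Group L] [Group G] (N : Numbering L)
    {r : ℕ → ℕ → ℕ} (hr : Computable₂ r) {H : ℕ → Subgroup L}
    (hH : ∀ n z, z ∈ H n ↔ ∃ a, N.val (r n a) = z) {R : ℕ × ℕ × ℕ → Prop}
    (hR : ComputablePred R) : ∃ f : ℕ → ℕ, Computable f ∧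
      ∀ n, f n ∈ indexSet G ↔ (∀ x, ∃ b, R (n, x, b)) ∧ Nonempty (H n ≃* G) := by
  obtain ⟨d, hd, hU⟩ := N.exists_diagram hr hH
  obtain ⟨f, hf, hphi⟩ := exists_index hd hR
  refine ⟨f, hf, fun n => ?_⟩
  obtain ⟨U, gU, ⟨e⟩, hdU⟩ := hU n
  have hchar : (∀ x, ∃ b, R (n, x, b)) → IsCharFun (phi (f n)) (atomicDiagram U) :=
    fun h x => by
      rw [(hphi n x).1 (h x), ← hdU]
      cases d n x <;> simp
  constructor
  · rintro ⟨U', gU', ⟨e'⟩, hc⟩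
    have htot : ∀ x, ∃ b, R (n, x, b) := fun x => by
      by_contra! hb
      have h0 := (hphi n x).2 hb
      by_cases hx : x ∈ atomicDiagram U'
      · have := h0.symm.trans ((hc x).1 hx)
        exact Part.some_ne_none _ this.symm
      · have := h0.symm.trans ((hc x).2 hx)
        exact Part.some_ne_none _ this.symm
    obtain ⟨e''⟩ := nonempty_mulEquiv_of_atomicDiagram_eq ((hchar htot).unique hc)
    exact ⟨htot, ⟨e.symm.trans (e''.trans e')⟩⟩
  · rintro ⟨htot, ⟨e'⟩⟩
    exact ⟨U, gU, ⟨e.trans e'⟩, hchar htot⟩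

theorem isHard_isPi2 {G : Type*} [Group G] (N : Numbering G) : IsHard IsPi2 (indexSet G) := by
  rintro S ⟨R, hR, hS⟩
  obtain ⟨f, hf, h⟩ := N.exists_reduction (G := G) (r := fun _ a => a) .snd (H := fun _ => ⊤)
    (fun n z => ⟨fun _ => N.surj z, fun _ => Subgroup.mem_top z⟩) hR
  refine ⟨f, hf, fun n => ?_⟩
  refine (hS n).trans ((h n).trans ?_).symm
  exact and_iff_left ⟨Subgroup.topEquiv⟩

/-! ## The ascending union of a self-embedding -/

section Limit

variable {G : Type*} [Group G] (ψ : G →* G)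

/-- The `j`-th map to the direct limit of `G → G → ⋯`, realized by germs of sequences. -/
def limitMap (j : ℕ) : G →* Filter.Germ (Filter.atTop : Filter ℕ) G where
  toFun x := ((fun s => ψ^[s - j] x : ℕ → G) : Filter.Germ Filter.atTop G)
  map_one' := by
    rw [← Filter.Germ.coe_one]
    congr 1
    funext s
    exact iterate_map_one ψ (s - j)
  map_mul' x y := by
    rw [← Filter.Germ.coe_mul]
    congr 1
    funext s
    exact iterate_map_mul ψ (s - j) x y

/-- The two sequences agree from `j + k` on; the truncated subtraction before that point is
invisible to germs. -/
theorem limitMap_iterate (j k : ℕ) (x : G) : limitMap ψ (j + k) (ψ^[k] x) = limitMap ψ j x := by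
  refine Filter.Germ.coe_eq.2 (Filter.eventually_atTop.2 ⟨j + k, fun s hs => ?_⟩)
  change ψ^[s - (j + k)] (ψ^[k] x) = ψ^[s - j] x
  rw [← Function.iterate_add_apply, show s - (j + k) + k = s - j by omega]

theorem limitMap_injective {ψ : G →* G} (hψ : Function.Injective ψ) (j : ℕ) :
    Function.Injective (limitMap ψ j) := fun x y h => by
  obtain ⟨s, hs⟩ := Filter.eventually_atTop.1 (Filter.Germ.coe_eq.1 h)
  exact hψ.iterate _ (hs s le_rfl)

theorem limitMap_range_mono : Monotone fun j => (limitMap ψ j).range := by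
  refine monotone_nat_of_le_succ fun j => ?_
  rintro _ ⟨x, rfl⟩
  exact ⟨ψ x, limitMap_iterate ψ j 1 x⟩

theorem mem_limit {z : Filter.Germ (Filter.atTop : Filter ℕ) G} :
    z ∈ (⨆ j, (limitMap ψ j).range) ↔ ∃ j x, limitMap ψ j x = z := by
  rw [Subgroup.mem_iSup_of_directed (limitMap_range_mono ψ).directed_le]
  rfl

/-- A number codes a stage and an element there. To multiply, push both factors to the sum of their
stages; triviality is tested at the given stage, since the stage maps are injective. -/
theorem nonempty_numbering_limit {ψ : G →* G} [Group.FG G] (hψ : Function.Injective ψ)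
    (N : Numbering G) : ∃ M : Numbering ↥(⨆ j, (limitMap ψ j).range),
      ∀ p, (M.val p : Filter.Germ (Filter.atTop : Filter ℕ) G) =
        limitMap ψ p.unpair.1 (N.val p.unpair.2) := by
  classical
  obtain ⟨f, hf, hfv⟩ := N.exists_hom N ψ
  have hfi : ∀ k x, N.val (f^[k] x) = ψ^[k] (N.val x) := fun k x => by
    induction k with
    | zero => rfl
    | succ k ih => rw [Function.iterate_succ_apply', Function.iterate_succ_apply', hfv, ih]
  have hA : Computable fun x : ℕ => x.unpair.1 := Computable.fst.comp .unpair
  have hB : Computable fun x : ℕ => x.unpair.2 := Computable.snd.comp .unpair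
  refine ⟨⟨fun p => ⟨limitMap ψ p.unpair.1 (N.val p.unpair.2), (mem_limit ψ).2 ⟨_, _, rfl⟩⟩,
    ?_, fun p q => Nat.pair (p.unpair.1 + q.unpair.1)
      (N.mul (f^[q.unpair.1] p.unpair.2) (f^[p.unpair.1] q.unpair.2)), ?_, ?_, ?_⟩, fun p => rfl⟩
  · rintro ⟨z, hz⟩
    obtain ⟨j, x, rfl⟩ := (mem_limit ψ).1 hz
    obtain ⟨a, rfl⟩ := N.surj x
    exact ⟨Nat.pair j a, Subtype.ext (by simp)⟩
  · exact Primrec₂.natPair.to_comp.comp (Primrec.nat_add.to_comp.comp (hA.comp .fst) (hA.comp .snd))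
      (N.computable_mul.comp (Computable.iterate (hA.comp .snd) (hB.comp .fst) hf)
        (Computable.iterate (hA.comp .fst) (hB.comp .snd) hf))
  · intro p q
    refine Subtype.ext ?_
    simp only [Nat.unpair_pair, N.val_mul, hfi, map_mul, Subgroup.coe_mul, limitMap_iterate]
    rw [add_comm, limitMap_iterate]
  · refine ComputablePred.of_eq (p := fun p : ℕ => N.val p.unpair.2 = 1)
      (Computable.computablePred (N.computablePred_eq_one.decide.comp hB)) fun p => ?_
    rw [Subtype.ext_iff, Subgroup.coe_one, map_eq_one_iff _ (limitMap_injective hψ _)]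

/-- If the union were isomorphic to `G`, its finitely many generators would lie in one stage `J`.
Then stage `J + 1` would equal stage `J`, making `ψ` onto. -/
theorem not_nonempty_limit_mulEquiv {ψ : G →* G} [Group.FG G] (hψ : Function.Injective ψ)
    (hr : ψ.range ≠ ⊤) : ¬ Nonempty (↥(⨆ j, (limitMap ψ j).range) ≃* G) := by
  rintro ⟨e⟩
  obtain ⟨n, x, hx⟩ := exists_fin_generators G
  let θ := (⨆ j, (limitMap ψ j).range).subtype.comp e.symm.toMonoidHom
  choose j hj using fun i => (mem_limit ψ).1 (e.symm (x i)).2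
  obtain ⟨J, hJ⟩ := (Set.finite_range j).bddAbove
  have hle : θ.range ≤ (limitMap ψ J).range := by
    rw [MonoidHom.range_eq_map, Subgroup.map_le_iff_le_comap, ← hx, Subgroup.closure_le]
    rintro _ ⟨i, rfl⟩
    obtain ⟨y, hy⟩ := hj i
    exact limitMap_range_mono ψ (hJ ⟨i, rfl⟩) ⟨y, hy⟩
  refine hr (eq_top_iff.2 fun y _ => ?_)
  obtain ⟨z, hz⟩ : limitMap ψ (J + 1) y ∈ (limitMap ψ J).range :=
    hle ⟨e ⟨limitMap ψ (J + 1) y, (mem_limit ψ).2 ⟨_, _, rfl⟩⟩, by simp [θ]⟩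
  rw [← limitMap_iterate ψ J 1] at hz
  exact ⟨z, limitMap_injective hψ _ hz⟩

end Limit

theorem isHard_isDSigma2 {G : Type*} [Group G] [Group.FG G] (N : Numbering G) {ψ : G →* G}
    (hψ : Function.Injective ψ) (hrange : ψ.range ≠ ⊤) : IsHard IsDSigma2 (indexSet G) := by
  classical
  rintro _ ⟨S₁, S₂, ⟨R₁, hR₁, hS₁⟩, ⟨R₂, hR₂, hS₂⟩, -, rfl⟩
  obtain ⟨M, hM⟩ := nonempty_numbering_limit hψ N
  obtain ⟨u, hu⟩ := N.surj 1
  -- Checks that the entries of `l` refute the first `j` candidate witnesses for `n ∈ S₁`.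
  let V : ℕ → List ℕ → ℕ → Bool := fun n l j =>
    Nat.rec true (fun a ih => ih && !decide (R₁ (n, a, l.getD a 0))) j
  have hV : Computable fun p : (ℕ × List ℕ) × ℕ => V p.1.1 p.1.2 p.2 := by
    refine Computable.nat_rec (h := fun (p : (ℕ × List ℕ) × ℕ) (q : ℕ × Bool) =>
      q.2 && !decide (R₁ (p.1.1, q.1, p.1.2.getD q.1 0))) .snd (.const true) ?_
    refine Primrec.and.to_comp.comp (Computable.snd.comp .snd) (Primrec.not.to_comp.comp
      (hR₁.decide.comp ?_))
    refine (Computable.fst.comp (Computable.fst.comp .fst)).pair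
      ((Computable.fst.comp .snd).pair ?_)
    exact (Primrec.list_getD 0).to_comp.comp (Computable.snd.comp (Computable.fst.comp .fst))
      (Computable.fst.comp .snd)
  have hV_iff : ∀ n l j, V n l j = true ↔ ∀ a < j, ¬ R₁ (n, a, l.getD a 0) := fun n l j => by
    induction j with
    | zero => simp [V]
    | succ j ih =>
      rw [Nat.forall_lt_succ_right, ← ih]
      simp [V]
  let D : ℕ → List ℕ := fun x => Denumerable.ofNat (List ℕ) x.unpair.1
  have hD : Computable D := (Computable.ofNat (List ℕ)).comp (Computable.fst.comp .unpair)
  -- A list of refutations of length `j` unlocks the `j`-th stage; a failed check enumerates the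
  -- identity element instead.
  let r : ℕ → ℕ → ℕ := fun n x => cond (V n (D x) (D x).length)
    (Nat.pair (D x).length x.unpair.2) (Nat.pair 0 u)
  have hr : Computable₂ r := Computable.cond
    (hV.comp ((Computable.fst.pair (hD.comp .snd)).pair
      (Computable.list_length.comp (hD.comp .snd))))
    (Primrec₂.natPair.to_comp.comp (Computable.list_length.comp (hD.comp .snd))
      (Computable.snd.comp (Computable.unpair.comp .snd))) (.const _)
  let Q : ℕ → ℕ → Prop := fun n j => ∀ a < j, ∃ b, ¬ R₁ (n, a, b)
  have hQ : ∀ n i j, i ≤ j → Q n j → Q n i := fun n i j hij h a ha => h a (ha.trans_le hij)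
  have hex : ∀ n, ∃ H : Subgroup ↥(⨆ j, (limitMap ψ j).range), ∀ z, z ∈ H ↔
      ∃ j, Q n j ∧ (z : Filter.Germ (Filter.atTop : Filter ℕ) G) ∈ (limitMap ψ j).range := by
    refine fun n => ⟨⟨⟨⟨{z | ∃ j, Q n j ∧
      (z : Filter.Germ (Filter.atTop : Filter ℕ) G) ∈ (limitMap ψ j).range}, ?_⟩, ?_⟩, ?_⟩,
      fun z => Iff.rfl⟩
    · rintro a b ⟨i, hi, ha⟩ ⟨j, hj, hb⟩
      rcases le_total i j with h | h
      · exact ⟨j, hj, mul_mem (limitMap_range_mono ψ h ha) hb⟩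
      · exact ⟨i, hi, mul_mem ha (limitMap_range_mono ψ h hb)⟩
    · exact ⟨0, by simp [Q], one_mem _⟩
    · rintro a ⟨i, hi, ha⟩
      exact ⟨i, hi, inv_mem ha⟩
  choose H hH using hex
  have hHr : ∀ n z, z ∈ H n ↔ ∃ a, M.val (r n a) = z := by
    intro n z
    rw [hH]
    constructor
    · rintro ⟨j, hj, ⟨x, hx⟩⟩
      obtain ⟨a, rfl⟩ := N.surj x
      choose! g hg using hj
      have hv : V n ((List.range j).map g) j = true := (hV_iff _ _ _).2 fun a ha => by
        simpa [ha] using hg a ha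
      refine ⟨Nat.pair (Encodable.encode ((List.range j).map g)) a, Subtype.ext ?_⟩
      rw [hM]
      simp [r, D, hv, hx]
    · rintro ⟨a, rfl⟩
      rw [hM]
      rcases Bool.eq_false_or_eq_true (V n (D a) (D a).length) with hv | hv
      · refine ⟨(D a).length, fun i hi => ⟨_, (hV_iff _ _ _).1 hv i hi⟩, ?_⟩
        simp [r, hv]
      · refine ⟨0, by simp [Q], ?_⟩
        simp [r, hv]
  -- Totality of the computed function now expresses `n ∉ S₂`, so it remains to show that `H n` is
  -- isomorphic to `G` exactly when `n ∈ S₁`.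
  obtain ⟨f, hf, hfn⟩ := M.exists_reduction (G := G) hr hHr hR₂.not
  refine ⟨f, hf, fun n => ?_⟩
  refine Iff.trans ?_ (hfn n).symm
  change n ∈ S₁ ∧ ¬ n ∈ S₂ ↔ _
  rw [and_comm]
  refine and_congr ?_ ?_
  · rw [hS₂]
    push Not
    rfl
  rw [hS₁]
  constructor
  · intro h
    -- The least true witness `a` is never refuted and all smaller ones are, so `H n` is exactly
    -- stage `a`, a copy of `G`.
    have hmin : ∀ {j}, j < Nat.find h → ¬ ∀ b, R₁ (n, j, b) := Nat.find_min h
    have hspec := Nat.find_spec h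
    generalize Nat.find h = a at hmin hspec
    have hQa : ∀ j, Q n j ↔ j ≤ a := fun j => by
      constructor
      · intro hj
        by_contra hlt
        obtain ⟨b, hb⟩ := hj a (not_le.1 hlt)
        exact hb (hspec b)
      · intro hj i hi
        simpa using hmin (hi.trans_le hj)
    have e : H n = ((limitMap ψ a).range).subgroupOf (⨆ j, (limitMap ψ j).range) := by
      ext z
      rw [hH, Subgroup.mem_subgroupOf]
      exact ⟨fun ⟨j, hj, hz⟩ => limitMap_range_mono ψ ((hQa j).1 hj) hz,
        fun hz => ⟨a, (hQa a).2 le_rfl, hz⟩⟩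
    rw [e]
    exact ⟨(Subgroup.subgroupOfEquivOfLe (le_iSup (fun j => (limitMap ψ j).range) a)).trans
      (MonoidHom.ofInjective (limitMap_injective hψ a)).symm⟩
  · rintro ⟨e⟩
    by_contra! hn
    have htop : H n = ⊤ := by
      refine eq_top_iff.2 fun z _ => (hH n z).2 ?_
      obtain ⟨j, x, hx⟩ := (mem_limit ψ).1 z.2
      exact ⟨j, fun a _ => hn a, x, hx⟩
    rw [htop] at e
    exact not_nonempty_limit_mulEquiv hψ hrange ⟨Subgroup.topEquiv.symm.trans e⟩

theorem exists_embedding_of_not_isCoHopfian {G : Type*} [Group G] (h : ¬ IsCoHopfian G) :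
    ∃ ψ : G →* G, Function.Injective ψ ∧ ψ.range ≠ ⊤ := by
  simp only [IsCoHopfian, not_forall] at h
  obtain ⟨H, ⟨e⟩, hH⟩ := h
  refine ⟨H.subtype.comp e.symm.toMonoidHom, H.subtype_injective.comp e.symm.injective, ?_⟩
  have he : e.symm.toMonoidHom.range = ⊤ := MonoidHom.range_eq_top.2 e.symm.surjective
  rw [MonoidHom.range_comp, he, ← MonoidHom.range_eq_map, Subgroup.range_subtype]
  exact hH

end CompGroup

namespace CompGroup

/-! ## Predicates uniformly decidable in a total function -/

/-- `f` is the total function with index `e`. -/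
def IsTotal (e : ℕ) (f : ℕ → ℕ) : Prop := ∀ i, phi e i = Part.some (f i)

theorem IsTotal.unique {e : ℕ} {f f' : ℕ → ℕ} (h : IsTotal e f) (h' : IsTotal e f') : f = f' :=
  funext fun i => Part.some_injective ((h i).symm.trans (h' i))

theorem partrec_phi : Partrec₂ phi :=
  Nat.Partrec.Code.eval_part.comp ((Computable.ofNat _).comp .fst) .snd

section Oracle

variable {α β γ δ : Type*} [Primcodable α] [Primcodable β] [Primcodable γ] [Primcodable δ]

/-- `c f x` is computable uniformly in an index of `f`. -/
def OComp (c : (ℕ → ℕ) → α → β) : Prop :=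
  ∃ F : ℕ × α →. β, Partrec F ∧ ∀ e f, IsTotal e f → ∀ x, F (e, x) = Part.some (c f x)

theorem OComp.of_computable {g : α → β} (hg : Computable g) : OComp fun _ x => g x :=
  ⟨_, (hg.comp .snd).partrec, fun _ _ _ _ => rfl⟩

theorem OComp.comp {g : β → γ} {c : (ℕ → ℕ) → α → β} (hg : Computable g) (hc : OComp c) :
    OComp fun f x => g (c f x) := by
  obtain ⟨F, hF, h⟩ := hc
  exact ⟨_, hF.map (hg.comp .snd).to₂, fun e f hf x => by simp [h e f hf x]⟩

theorem OComp.comp₂ {g : β → γ → δ} {c : (ℕ → ℕ) → α → β} {d : (ℕ → ℕ) → α → γ}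
    (hg : Computable₂ g) (hc : OComp c) (hd : OComp d) : OComp fun f x => g (c f x) (d f x) := by
  obtain ⟨F, hF, h⟩ := hc
  obtain ⟨F', hF', h'⟩ := hd
  refine ⟨fun p => (F p).bind fun y => (F' p).map fun z => g y z, hF.bind ((hF'.comp .fst).map
    (hg.comp (Computable.snd.comp .fst) .snd).to₂).to₂, fun e f hf x => ?_⟩
  simp [h e f hf x, h' e f hf x]

theorem OComp.query {i : α → ℕ} (hi : Computable i) : OComp fun f x => f (i x) :=
  ⟨_, partrec_phi.comp .fst (hi.comp .snd), fun _ _ hf x => hf (i x)⟩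

open Classical in
/-- A predicate decidable uniformly in an index of a total function. -/
def OPred (P : (ℕ → ℕ) → α → Prop) : Prop := OComp fun f x => decide (P f x)

namespace OPred

variable {P Q : (ℕ → ℕ) → α → Prop}

theorem of_eq (hP : OPred P) (h : ∀ f x, P f x ↔ Q f x) : OPred Q :=
  (funext fun f => funext fun x => propext (h f x) : P = Q) ▸ hP

theorem of_computablePred {p : α → Prop} (hp : ComputablePred p) : OPred fun _ x => p x := by
  classical exact OComp.of_computable hp.decide

theorem and (hP : OPred P) (hQ : OPred Q) : OPred fun f x => P f x ∧ Q f x := by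
  refine (congrArg OComp ?_).mp (OComp.comp₂ Primrec.and.to_comp hP hQ)
  funext f x
  by_cases h : P f x <;> by_cases h' : Q f x <;> simp [h, h']

theorem not (hP : OPred P) : OPred fun f x => ¬ P f x := by
  refine (congrArg OComp ?_).mp (OComp.comp Primrec.not.to_comp hP)
  funext f x
  simp

theorem or (hP : OPred P) (hQ : OPred Q) : OPred fun f x => P f x ∨ Q f x :=
  (hP.not.and hQ.not).not.of_eq fun f x => by tauto

theorem imp (hP : OPred P) (hQ : OPred Q) : OPred fun f x => P f x → Q f x :=
  (hP.and hQ.not).not.of_eq fun f x => by tauto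

theorem iff (hP : OPred P) (hQ : OPred Q) : OPred fun f x => (P f x ↔ Q f x) :=
  ((hP.imp hQ).and (hQ.imp hP)).of_eq fun f x => by tauto

theorem query_eq {i : α → ℕ} (hi : Computable i) (v : ℕ) : OPred fun f x => f (i x) = v := by
  refine (congrArg OComp ?_).mp (OComp.comp (g := fun y => decide (y = v))
    ((Primrec.eq (α := ℕ)).decide.comp .id (.const v)).to_comp (OComp.query hi))
  funext f x
  simp

theorem forall_mem_list {ι : Type*} (l : List ι) {P : ι → (ℕ → ℕ) → α → Prop}
    (h : ∀ i, OPred (P i)) : OPred fun f x => ∀ i ∈ l, P i f x := by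
  induction l with
  | nil => exact (of_computablePred (p := fun _ => True)
      ⟨fun _ => isTrue trivial, by simpa using Computable.const true⟩).of_eq (by simp)
  | cons i l ih => exact ((h i).and ih).of_eq (by simp)

theorem forall_fin {n : ℕ} {P : Fin n → (ℕ → ℕ) → α → Prop} (h : ∀ j, OPred (P j)) :
    OPred fun f x => ∀ j, P j f x :=
  (forall_mem_list (List.finRange n) h).of_eq (by simp)

theorem comp {P : (ℕ → ℕ) → β → Prop} (hP : OPred P) {h : α → β} (hh : Computable h) :
    OPred fun f x => P f (h x) := by
  obtain ⟨F, hF, hv⟩ := hP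
  exact ⟨_, hF.comp (Computable.fst.pair (hh.comp .snd)), fun e f hf x => hv e f hf (h x)⟩

end OPred

/-! ## The class of `Π₂` sets -/

/-- The existential witness is a step bound for the halting computation. -/
theorem isPi2_of_rePred {Q : ℕ × ℕ → Prop} (hQ : REPred Q) : IsPi2 {n | ∀ a, Q (n, a)} := by
  obtain ⟨c, hc⟩ := Nat.Partrec.Code.exists_code.1 hQ
  refine ⟨fun p => (Nat.Partrec.Code.evaln p.2.2 c (Nat.pair p.1 p.2.1)).isSome = true, ?_, ?_⟩
  · refine Computable.computablePred ?_
    simp only [Bool.decide_eq_true]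
    exact Primrec.option_isSome.to_comp.comp (Nat.Partrec.Code.primrec_evaln.to_comp.comp
      (((Computable.snd.comp .snd).pair (.const c)).pair
        (Primrec₂.natPair.to_comp.comp .fst (Computable.fst.comp .snd))))
  · intro n
    refine forall_congr' fun a => ?_
    have h1 : (c.eval (Nat.pair n a)).Dom ↔ Q (n, a) := by
      rw [hc]
      change (Part.bind (Encodable.decode (α := ℕ × ℕ) (Encodable.encode (n, a)) :
        Part (ℕ × ℕ)) _).Dom ↔ _
      rw [Encodable.encodek]
      simp [Part.assert]
    rw [← h1, Part.dom_iff_mem]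
    simp only [Nat.Partrec.Code.evaln_complete, Option.isSome_iff_exists]
    exact exists_comm

theorem IsPi2.inter {S T : Set ℕ} (hS : IsPi2 S) (hT : IsPi2 T) : IsPi2 (S ∩ T) := by
  classical
  obtain ⟨R, hR, h⟩ := hS
  obtain ⟨R', hR', h'⟩ := hT
  refine ⟨fun p => (decide (R (p.1, p.2.1, p.2.2.unpair.1)) &&
    decide (R' (p.1, p.2.1, p.2.2.unpair.2))) = true, Computable.computablePred ?_, fun n => ?_⟩
  · simp only [Bool.decide_eq_true]
    have hb : Computable fun p : ℕ × ℕ × ℕ => p.2.2.unpair :=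
      Computable.unpair.comp (Computable.snd.comp .snd)
    exact Primrec.and.to_comp.comp
      (hR.decide.comp (Computable.fst.pair ((Computable.fst.comp .snd).pair (Computable.fst.comp hb))))
      (hR'.decide.comp
        (Computable.fst.pair ((Computable.fst.comp .snd).pair (Computable.snd.comp hb))))
  · simp only [Set.mem_inter_iff, h, h', Bool.and_eq_true, decide_eq_true_iff, ← forall_and]
    refine forall_congr' fun a => ⟨fun ⟨⟨b, hb⟩, ⟨b', hb'⟩⟩ => ⟨Nat.pair b b', by simp [hb, hb']⟩,
      fun ⟨b, hb, hb'⟩ => ⟨⟨_, hb⟩, ⟨_, hb'⟩⟩⟩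

theorem IsPi2.union {S T : Set ℕ} (hS : IsPi2 S) (hT : IsPi2 T) : IsPi2 (S ∪ T) := by
  classical
  obtain ⟨R, hR, h⟩ := hS
  obtain ⟨R', hR', h'⟩ := hT
  refine ⟨fun p => (decide (R (p.1, p.2.1.unpair.1, p.2.2)) ||
    decide (R' (p.1, p.2.1.unpair.2, p.2.2))) = true, Computable.computablePred ?_, fun n => ?_⟩
  · simp only [Bool.decide_eq_true]
    have hb : Computable fun p : ℕ × ℕ × ℕ => p.2.1.unpair :=
      Computable.unpair.comp (Computable.fst.comp .snd)
    exact Primrec.or.to_comp.comp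
      (hR.decide.comp (Computable.fst.pair ((Computable.fst.comp hb).pair (Computable.snd.comp .snd))))
      (hR'.decide.comp
        (Computable.fst.pair ((Computable.snd.comp hb).pair (Computable.snd.comp .snd))))
  · simp only [Set.mem_union, h, h', Bool.or_eq_true, decide_eq_true_iff, exists_or]
    constructor
    · rintro (hn | hn) a
      · exact Or.inl (hn _)
      · exact Or.inr (hn _)
    · intro hn
      by_contra! hcon
      obtain ⟨⟨a, ha⟩, ⟨b, hb⟩⟩ := hcon
      rcases hn (Nat.pair a b) with ⟨k, hk⟩ | ⟨k, hk⟩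
      · exact ha k (by simpa using hk)
      · exact hb k (by simpa using hk)

theorem IsPi2.compl {S : Set ℕ} (hS : IsPi2 S) : IsSigma2 Sᶜ := by
  obtain ⟨R, hR, h⟩ := hS
  refine ⟨fun p => ¬ R p, hR.not, fun n => ?_⟩
  rw [Set.mem_compl_iff, h]
  push Not
  rfl

/-- Rewrite `S \ T` as `Tᶜ \ (S ∪ T)ᶜ`, where both sets are `Σ₂` and are nested. -/
theorem IsPi2.isDSigma2_diff {S T : Set ℕ} (hS : IsPi2 S) (hT : IsPi2 T) :
    IsDSigma2 (S \ T) := by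
  refine ⟨Tᶜ, (S ∪ T)ᶜ, hT.compl, (hS.union hT).compl, ?_, ?_⟩
  · exact Set.compl_subset_compl.2 Set.subset_union_right
  · ext n
    simp only [Set.mem_sdiff, Set.mem_compl_iff, Set.mem_union]
    tauto

/-- One universal number codes a pair: an input at which `phi e` must converge, and an `x` for which
the search for `y` must halt. The behaviour of the search on partial `phi e` is irrelevant, because
totality is demanded too. -/
theorem OPred.isPi2 {P : (ℕ → ℕ) → α × β → Prop} (hP : OPred P) :
    IsPi2 {e | ∃ f, IsTotal e f ∧ ∀ x, ∃ y, P f (x, y)} := by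
  classical
  obtain ⟨F, hF, hv⟩ := hP
  let F' : (ℕ × α) × ℕ →. Bool := fun p =>
    Option.casesOn (Encodable.decode (α := β) p.2) (Part.some false) fun y => F (p.1.1, p.1.2, y)
  have hF' : Partrec F' := by
    refine Partrec.optionCasesOn_right (f := fun _ => false) (Computable.decode.comp .snd)
      (.const false) (hF.comp ?_)
    exact (Computable.fst.comp (Computable.fst.comp .fst)).pair
      ((Computable.snd.comp (Computable.fst.comp .fst)).pair .snd)
  let K : ℕ × ℕ →. ℕ := fun p =>
    Option.casesOn (Encodable.decode (α := α) p.2) (Part.some 0)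
      fun x => Nat.rfind fun k => F' ((p.1, x), k)
  have hK : Partrec K :=
    Partrec.optionCasesOn_right (f := fun _ => 0) (Computable.decode.comp .snd) (.const 0)
      (Partrec.rfind (hF'.comp (((Computable.fst.comp (Computable.fst.comp .fst)).pair
        (Computable.snd.comp .fst)).pair .snd)))
  have hQ := ((partrec_phi.comp .fst (Computable.fst.comp (Computable.unpair.comp .snd))).bind
    (hK.comp ((Computable.fst.comp .fst).pair
      (Computable.snd.comp (Computable.unpair.comp (Computable.snd.comp .fst))))).to₂ :
      Partrec fun p : ℕ × ℕ => (phi p.1 p.2.unpair.1).bind fun _ => K (p.1, p.2.unpair.2)).dom_re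
  have key : ∀ e f, IsTotal e f → ((∀ b, (K (e, b)).Dom) ↔ ∀ x, ∃ y, P f (x, y)) := by
    intro e f hf
    have hF'v : ∀ x k, F' ((e, x), k) = Part.some
        (Option.casesOn (Encodable.decode (α := β) k) false fun y => decide (P f (x, y))) := by
      intro x k
      simp only [F']
      cases Encodable.decode (α := β) k with
      | none => rfl
      | some y => exact hv e f hf (x, y)
    have hdom : ∀ x, (Nat.rfind fun k => F' ((e, x), k)).Dom ↔ ∃ y, P f (x, y) := by
      intro x
      refine Nat.rfind_dom.trans ?_
      constructor
      · rintro ⟨k, hk, -⟩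
        rw [hF'v, Part.mem_some_iff] at hk
        cases hd : Encodable.decode (α := β) k with
        | none => simp [hd] at hk
        | some y => exact ⟨y, by simpa [hd] using hk⟩
      · rintro ⟨y, hy⟩
        refine ⟨Encodable.encode y, ?_, fun {m} _ => ?_⟩
        · rw [hF'v, Encodable.encodek]; simpa using hy
        · rw [hF'v]; trivial
    constructor
    · intro h x
      have := h (Encodable.encode x)
      simp only [K, Encodable.encodek] at this
      exact (hdom x).1 this
    · intro h b
      simp only [K]
      cases Encodable.decode (α := α) b with
      | none => trivial
      | some x => exact (hdom x).2 (h x)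
  have heq : {e | ∃ f, IsTotal e f ∧ ∀ x, ∃ y, P f (x, y)} =
      {e | ∀ a : ℕ, ((phi e a.unpair.1).bind fun _ => K (e, a.unpair.2)).Dom} := by
    ext e
    simp only [Set.mem_ofPred_eq, Part.bind_dom]
    constructor
    · rintro ⟨f, hf, h⟩ a
      exact ⟨by rw [hf]; trivial, (key e f hf).2 h _⟩
    · intro h
      have ht : ∀ i, (phi e i).Dom := fun i => by simpa using (h (Nat.pair i 0)).1
      refine ⟨fun i => (phi e i).get (ht i), fun i => (Part.some_get (ht i)).symm, ?_⟩
      refine (key e _ fun i => (Part.some_get (ht i)).symm).1 fun b => ?_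
      simpa using (h (Nat.pair 0 b)).2
  rw [heq]
  exact isPi2_of_rePred hQ

end Oracle

/-! ## Axioms for characteristic functions of atomic diagrams -/

/-- The equation `t = s` is accepted by `f`. -/
def Holds (f : ℕ → ℕ) (t s : GTerm ℕ) : Prop := f (eqCode t s) = 1

open GTerm in
/-- The function `f` is the characteristic function of the atomic diagram of a group. -/
structure IsDiagramFun (f : ℕ → ℕ) : Prop where
  zero_or_one : ∀ k, f k = 0 ∨ f k = 1
  ne_iff : ∀ t s, f (eqCode t s + 1) = 1 ↔ Holds f t t ∧ Holds f s s ∧ ¬ Holds f t s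
  left : ∀ t s, Holds f t s → Holds f t t
  symm : ∀ t s, Holds f t s → Holds f s t
  trans : ∀ t s r, Holds f t s → Holds f s r → Holds f t r
  one_refl : Holds f one one
  inv_iff : ∀ t, Holds f (inv t) (inv t) ↔ Holds f t t
  mul_iff : ∀ t s, Holds f (mul t s) (mul t s) ↔ Holds f t t ∧ Holds f s s
  inv_congr : ∀ t s, Holds f t s → Holds f (inv t) (inv s)
  mul_congr : ∀ t s t' s', Holds f t s → Holds f t' s' → Holds f (mul t t') (mul s s')
  assoc : ∀ t s r, Holds f t t → Holds f s s → Holds f r r →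
    Holds f (mul (mul t s) r) (mul t (mul s r))
  one_mul : ∀ t, Holds f t t → Holds f (mul one t) t
  inv_mul : ∀ t, Holds f t t → Holds f (mul (inv t) t) one
  const_inj : ∀ a b, Holds f (const a) (const b) → a = b
  exists_const : ∀ t, Holds f t t → ∃ a, Holds f t (const a)

section OHolds

variable {α : Type*} [Primcodable α]

theorem computable_eqCode : Computable₂ eqCode :=
  (Primrec.nat_mul.comp (.const 2) .id).to_comp.comp (Primrec₂.natPair.to_comp.comp
    (GTerm.computable_toNat.comp .fst) (GTerm.computable_toNat.comp .snd))

theorem OPred.holds {t s : α → GTerm ℕ} (ht : Computable t) (hs : Computable s) :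
    OPred fun f x => Holds f (t x) (s x) :=
  OPred.query_eq (computable_eqCode.comp ht hs) 1

end OHolds

open GTerm in
theorem isPi2_isDiagramFun : IsPi2 {e | ∃ f, IsTotal e f ∧ IsDiagramFun f} := by
  let T := GTerm ℕ
  let t : (T × T × T × T × ℕ × ℕ) × ℕ → T := fun p => p.1.1
  let s : (T × T × T × T × ℕ × ℕ) × ℕ → T := fun p => p.1.2.1
  let t' : (T × T × T × T × ℕ × ℕ) × ℕ → T := fun p => p.1.2.2.1
  let s' : (T × T × T × T × ℕ × ℕ) × ℕ → T := fun p => p.1.2.2.2.1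
  let a : (T × T × T × T × ℕ × ℕ) × ℕ → ℕ := fun p => p.1.2.2.2.2.1
  let b : (T × T × T × T × ℕ × ℕ) × ℕ → ℕ := fun p => p.1.2.2.2.2.2
  let y : (T × T × T × T × ℕ × ℕ) × ℕ → ℕ := fun p => p.2
  have ht : Computable t := Computable.fst.comp .fst
  have h1 : Computable fun p : (T × T × T × T × ℕ × ℕ) × ℕ => p.1.2 := Computable.snd.comp .fst
  have hs : Computable s := Computable.fst.comp h1
  have h2 : Computable fun p : (T × T × T × T × ℕ × ℕ) × ℕ => p.1.2.2 := Computable.snd.comp h1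
  have ht' : Computable t' := Computable.fst.comp h2
  have h3 : Computable fun p : (T × T × T × T × ℕ × ℕ) × ℕ => p.1.2.2.2 := Computable.snd.comp h2
  have hs' : Computable s' := Computable.fst.comp h3
  have h4 : Computable fun p : (T × T × T × T × ℕ × ℕ) × ℕ => p.1.2.2.2.2 := Computable.snd.comp h3
  have ha : Computable a := Computable.fst.comp h4
  have hb : Computable b := Computable.snd.comp h4
  have hy : Computable y := .snd
  have hab : OPred fun (_ : ℕ → ℕ) p => a p = b p := OPred.of_computablePred
    (Computable.computablePred ((Primrec.eq (α := ℕ)).decide.to_comp.comp ha hb))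
  have mk := fun (u v) (hu : Computable u) (hv : Computable v) =>
    OPred.holds (α := (T × T × T × T × ℕ × ℕ) × ℕ) (t := u) (s := v) hu hv
  have hone : Computable fun _ : (T × T × T × T × ℕ × ℕ) × ℕ => (one : T) := .const _
  have hinv := fun {u : (T × T × T × T × ℕ × ℕ) × ℕ → T} (hu : Computable u) =>
    computable_inv.comp hu
  have hmul := fun {u v : (T × T × T × T × ℕ × ℕ) × ℕ → T} (hu : Computable u)
    (hv : Computable v) => computable_mul.comp hu hv
  have hcst := fun {u : (T × T × T × T × ℕ × ℕ) × ℕ → ℕ} (hu : Computable u) =>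
    computable_const.comp hu
  have htt := mk _ _ ht ht
  have hss := mk _ _ hs hs
  have hts := mk _ _ ht hs
  have hall := ((OPred.query_eq ha 0).or (OPred.query_eq ha 1)).and <|
    ((OPred.query_eq (Computable.succ.comp (computable_eqCode.comp ht hs)) 1).iff
      (htt.and (hss.and hts.not))).and <|
    (hts.imp htt).and <|
    (hts.imp (mk _ _ hs ht)).and <|
    (hts.imp ((mk _ _ hs ht').imp (mk _ _ ht ht'))).and <|
    (mk _ _ hone hone).and <|
    ((mk _ _ (hinv ht) (hinv ht)).iff htt).and <|
    ((mk _ _ (hmul ht hs) (hmul ht hs)).iff (htt.and hss)).and <|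
    (hts.imp (mk _ _ (hinv ht) (hinv hs))).and <|
    (hts.imp ((mk _ _ ht' hs').imp (mk _ _ (hmul ht ht') (hmul hs hs')))).and <|
    (htt.imp (hss.imp ((mk _ _ ht' ht').imp
      (mk _ _ (hmul (hmul ht hs) ht') (hmul ht (hmul hs ht')))))).and <|
    (htt.imp (mk _ _ (hmul hone ht) ht)).and <|
    (htt.imp (mk _ _ (hmul (hinv ht) ht) hone)).and <|
    ((mk _ _ (hcst ha) (hcst hb)).imp hab).and
    -- This is the only clause that uses the existential witness `y`; all the others are purely
    -- universal.
    (htt.imp (mk _ _ ht (hcst hy)))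
  have hpi := hall.isPi2
  refine (congrArg IsPi2 ?_).mp hpi
  ext e
  refine exists_congr fun f => and_congr_right fun _ => ⟨fun h => ?_, fun h => ?_⟩
  · have H := fun t s t' s' a b => h (t, s, t', s', a, b)
    refine ⟨fun k => ?_, fun t s => ?_, fun t s => ?_, fun t s => ?_, fun t s r => ?_, ?_,
      fun t => ?_, fun t s => ?_, fun t s => ?_, fun t s t' s' => ?_, fun t s r => ?_,
      fun t => ?_, fun t => ?_, fun a b => ?_, fun t ht => ?_⟩
    · obtain ⟨_, h, _⟩ := H .one .one .one .one k 0
      exact h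
    · obtain ⟨_, _, h, _⟩ := H t s .one .one 0 0
      exact h
    · obtain ⟨_, _, _, h, _⟩ := H t s .one .one 0 0
      exact h
    · obtain ⟨_, _, _, _, h, _⟩ := H t s .one .one 0 0
      exact h
    · obtain ⟨_, _, _, _, _, h, _⟩ := H t s r .one 0 0
      exact h
    · obtain ⟨_, _, _, _, _, _, h, _⟩ := H .one .one .one .one 0 0
      exact h
    · obtain ⟨_, _, _, _, _, _, _, h, _⟩ := H t .one .one .one 0 0
      exact h
    · obtain ⟨_, _, _, _, _, _, _, _, h, _⟩ := H t s .one .one 0 0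
      exact h
    · obtain ⟨_, _, _, _, _, _, _, _, _, h, _⟩ := H t s .one .one 0 0
      exact h
    · obtain ⟨_, _, _, _, _, _, _, _, _, _, h, _⟩ := H t s t' s' 0 0
      exact h
    · obtain ⟨_, _, _, _, _, _, _, _, _, _, _, h, _⟩ := H t s r .one 0 0
      exact h
    · obtain ⟨_, _, _, _, _, _, _, _, _, _, _, _, h, _⟩ := H t .one .one .one 0 0
      exact h
    · obtain ⟨_, _, _, _, _, _, _, _, _, _, _, _, _, h, _⟩ := H t .one .one .one 0 0
      exact h
    · obtain ⟨_, _, _, _, _, _, _, _, _, _, _, _, _, _, h, _⟩ := H .one .one .one .one a b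
      exact h
    · obtain ⟨y, _, _, _, _, _, _, _, _, _, _, _, _, _, _, h⟩ := H t .one .one .one 0 0
      exact ⟨y, h ht⟩
  · rintro ⟨t, s, t', s', a, b⟩
    -- The existential is moved in front of the implication; 0 is a dummy for terms that are not
    -- accepted.
    have hex : ∃ y, Holds f t t → Holds f t (const y) := by
      by_cases htt : Holds f t t
      · exact (h.exists_const t htt).imp fun _ h _ => h
      · exact ⟨0, fun h => absurd h htt⟩
    obtain ⟨y, hy⟩ := hex
    exact ⟨y, h.zero_or_one a, h.ne_iff t s, h.left t s, h.symm t s, h.trans t s t', h.one_refl,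
      h.inv_iff t, h.mul_iff t s, h.inv_congr t s, h.mul_congr t s t' s', h.assoc t s t',
      h.one_mul t, h.inv_mul t, h.const_inj a b, hy⟩

/-- The total function `f` is the characteristic function of `D`. -/
def IsChar (f : ℕ → ℕ) (D : Set ℕ) : Prop := ∀ x, (x ∈ D → f x = 1) ∧ (x ∉ D → f x = 0)

theorem IsChar.eq_one_iff {f : ℕ → ℕ} {D : Set ℕ} (h : IsChar f D) (x : ℕ) :
    f x = 1 ↔ x ∈ D := by
  refine ⟨fun h1 => ?_, (h x).1⟩
  by_contra hx
  rw [(h x).2 hx] at h1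
  exact zero_ne_one h1

theorem isCharFun_phi_iff {e : ℕ} {D : Set ℕ} :
    IsCharFun (phi e) D ↔ ∃ f, IsTotal e f ∧ IsChar f D := by
  classical
  constructor
  · intro h
    refine ⟨fun x => if x ∈ D then 1 else 0, fun x => ?_, fun x => ?_⟩
    · by_cases hx : x ∈ D <;> simp [hx, h x]
    · by_cases hx : x ∈ D <;> simp [hx]
  · rintro ⟨f, hf, hD⟩ x
    rw [hf]
    exact ⟨fun hx => by rw [(hD x).1 hx], fun hx => by rw [(hD x).2 hx]⟩

open GTerm in
theorem IsChar.isDiagramFun {f : ℕ → ℕ} {U : Set ℕ} [Group U] (h : IsChar f (atomicDiagram U)) :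
    IsDiagramFun f := by
  classical
  let p : ℕ → Bool := fun a => decide (a ∈ U)
  have hp : ∀ a, p a = true ↔ a ∈ U := fun a => decide_eq_true_iff
  -- Extending the assignment by 1 outside `U` lets every term over `ℕ` be evaluated; acceptance
  -- then means that all constants lie in `U` and the values agree.
  let ε : ℕ → U := fun a => if h : a ∈ U then ⟨a, h⟩ else 1
  have hε : ∀ t : GTerm U, t.incl.lift ε = t.eval := fun t => by
    rw [incl, lift_bind, eval_eq_lift]
    congr 1
    funext a
    simp [ε]
  have hE : ∀ t s, Holds f t s ↔
      t.allConst p = true ∧ s.allConst p = true ∧ t.lift ε = s.lift ε := by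
    intro t s
    rw [Holds, h.eq_one_iff, eqCode_mem_iff, allConst_iff hp, allConst_iff hp]
    constructor
    · rintro ⟨t', s', rfl, rfl, he⟩
      exact ⟨⟨t', rfl⟩, ⟨s', rfl⟩, by rw [hε, hε, he]⟩
    · rintro ⟨⟨t', rfl⟩, ⟨s', rfl⟩, he⟩
      exact ⟨t', s', rfl, rfl, by rwa [hε, hε] at he⟩
  have hinv : ∀ t : GTerm ℕ, (inv t).allConst p = t.allConst p := fun t => rfl
  have hmul : ∀ t s : GTerm ℕ, (mul t s).allConst p = (t.allConst p && s.allConst p) :=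
    fun t s => rfl
  have hone : (one : GTerm ℕ).allConst p = true := rfl
  have hcst : ∀ a, (const a : GTerm ℕ).allConst p = p a := fun a => rfl
  constructor
  case zero_or_one =>
    intro k
    by_cases hk : k ∈ atomicDiagram U
    · exact Or.inr ((h k).1 hk)
    · exact Or.inl ((h k).2 hk)
  case ne_iff =>
    intro t s
    rw [h.eq_one_iff, eqCode_succ_mem_iff]
    simp only [hE, allConst_iff hp]
    constructor
    · rintro ⟨t', s', rfl, rfl, he⟩
      refine ⟨⟨⟨t', rfl⟩, ⟨t', rfl⟩, trivial⟩, ⟨⟨s', rfl⟩, ⟨s', rfl⟩, trivial⟩, fun hc => he ?_⟩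
      have := hc.2.2
      rwa [hε, hε] at this
    · rintro ⟨⟨⟨t', rfl⟩, -, -⟩, ⟨⟨s', rfl⟩, -, -⟩, hn⟩
      exact ⟨t', s', rfl, rfl, fun he => hn ⟨⟨t', rfl⟩, ⟨s', rfl⟩, by rw [hε, hε, he]⟩⟩
  case const_inj =>
    intro a b hab
    rw [hE, hcst, hcst, hp, hp] at hab
    obtain ⟨ha, hb, e⟩ := hab
    simpa [ε, ha, hb] using e
  case exists_const =>
    intro t ht
    refine ⟨(t.lift ε : U), ?_⟩
    rw [hE] at ht ⊢
    refine ⟨ht.1, (hp _).2 (t.lift ε).2, ?_⟩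
    simp [ε]
  all_goals intros; simp_all [mul_assoc]

-- Every accepted term is provably equal to exactly one constant, so the accepted constants form a
-- term model: operations are defined by taking normal forms, and the group axioms follow from the
-- accepted equations.
open GTerm in
theorem IsDiagramFun.exists_isChar {f : ℕ → ℕ} (h : IsDiagramFun f) :
    ∃ (U : Set ℕ) (_ : Group U), IsChar f (atomicDiagram U) := by
  let U : Set ℕ := {a | Holds f (const a) (const a)}
  have right : ∀ t s, Holds f t s → Holds f s s := fun t s hts => h.left _ _ (h.symm _ _ hts)
  have huniq : ∀ t (a b : U), Holds f t (const (a : ℕ)) → Holds f t (const (b : ℕ)) → a = b :=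
    fun t a b ha hb => Subtype.ext (h.const_inj _ _ (h.trans _ _ _ (h.symm _ _ ha) hb))
  have hnf : ∀ t, ∃ a : U, Holds f t t → Holds f t (const (a : ℕ)) := by
    obtain ⟨o, ho⟩ := h.exists_const one h.one_refl
    intro t
    by_cases ht : Holds f t t
    · obtain ⟨a, ha⟩ := h.exists_const t ht
      exact ⟨⟨a, right _ _ ha⟩, fun _ => ha⟩
    · exact ⟨⟨o, right _ _ ho⟩, fun h' => absurd h' ht⟩
  choose nf hnf using hnf
  let _ : Mul U := ⟨fun a b => nf (mul (const (a : ℕ)) (const (b : ℕ)))⟩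
  let _ : Inv U := ⟨fun a => nf (inv (const (a : ℕ)))⟩
  let _ : One U := ⟨nf one⟩
  have hm : ∀ a b : U, Holds f (mul (const (a : ℕ)) (const (b : ℕ))) (const ((a * b : U) : ℕ)) :=
    fun a b => hnf _ ((h.mul_iff _ _).2 ⟨a.2, b.2⟩)
  have hi : ∀ a : U, Holds f (inv (const (a : ℕ))) (const ((a⁻¹ : U) : ℕ)) :=
    fun a => hnf _ ((h.inv_iff _).2 a.2)
  have ho : Holds f one (const ((1 : U) : ℕ)) := hnf _ h.one_refl
  let G : Group U := Group.ofLeftAxioms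
    (fun a b c => by
      refine huniq (mul (mul (const (a : ℕ)) (const (b : ℕ))) (const (c : ℕ))) _ _ ?_ ?_
      · exact h.trans _ _ _ (h.mul_congr _ _ _ _ (hm a b) c.2) (hm _ c)
      · refine h.trans _ _ _ (h.assoc _ _ _ a.2 b.2 c.2) ?_
        exact h.trans _ _ _ (h.mul_congr _ _ _ _ a.2 (hm b c)) (hm a _))
    (fun a => by
      refine huniq (mul one (const (a : ℕ))) _ _ ?_ (h.one_mul _ a.2)
      exact h.trans _ _ _ (h.mul_congr _ _ _ _ ho a.2) (hm 1 a))
    (fun a => by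
      refine huniq (mul (inv (const (a : ℕ))) (const (a : ℕ))) _ _ ?_
        (h.trans _ _ _ (h.inv_mul _ a.2) ho)
      exact h.trans _ _ _ (h.mul_congr _ _ _ _ (hi a) a.2) (hm _ a))
  refine ⟨U, G, ?_⟩
  have hev : ∀ t : GTerm U, Holds f t.incl (const (t.eval : ℕ)) := by
    intro t
    induction t with
    | const a => exact a.2
    | one => exact ho
    | inv t ih => exact h.trans _ _ _ (h.inv_congr _ _ ih) (hi _)
    | mul t s iht ihs => exact h.trans _ _ _ (h.mul_congr _ _ _ _ iht ihs) (hm _ _)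
  have hincl : ∀ t : GTerm ℕ, Holds f t t → ∃ t' : GTerm U, t'.incl = t := by
    intro t
    induction t with
    | const a => exact fun ha => ⟨const ⟨a, ha⟩, rfl⟩
    | one => exact fun _ => ⟨one, rfl⟩
    | inv t ih =>
      intro ht
      obtain ⟨t', rfl⟩ := ih ((h.inv_iff _).1 ht)
      exact ⟨inv t', rfl⟩
    | mul t s iht ihs =>
      intro hts
      obtain ⟨t', rfl⟩ := iht ((h.mul_iff _ _).1 hts).1
      obtain ⟨s', rfl⟩ := ihs ((h.mul_iff _ _).1 hts).2
      exact ⟨mul t' s', rfl⟩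
  have hE : ∀ t s : GTerm U, Holds f t.incl s.incl ↔ t.eval = s.eval := fun t s => by
    constructor
    · intro hts
      exact huniq t.incl _ _ (hev t) (h.trans _ _ _ hts (hev s))
    · intro he
      exact h.trans _ _ _ (hev t) (he ▸ h.symm _ _ (hev s))
  have hone : ∀ x, f x = 1 ↔ x ∈ atomicDiagram U := by
    intro x
    obtain ⟨t, s, rfl | rfl⟩ := exists_eqCode x
    · rw [eqCode_mem_iff]
      constructor
      · intro hts
        obtain ⟨t', rfl⟩ := hincl t (h.left _ _ hts)
        obtain ⟨s', rfl⟩ := hincl s (right _ _ hts)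
        exact ⟨t', s', rfl, rfl, (hE _ _).1 hts⟩
      · rintro ⟨t', s', rfl, rfl, he⟩
        exact (hE _ _).2 he
    · rw [eqCode_succ_mem_iff, h.ne_iff]
      constructor
      · rintro ⟨ht, hs, hn⟩
        obtain ⟨t', rfl⟩ := hincl t ht
        obtain ⟨s', rfl⟩ := hincl s hs
        exact ⟨t', s', rfl, rfl, fun he => hn ((hE _ _).2 he)⟩
      · rintro ⟨t', s', rfl, rfl, he⟩
        exact ⟨(hE _ _).2 rfl, (hE _ _).2 rfl, fun hn => he ((hE _ _).1 hn)⟩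
  exact fun x => ⟨(hone x).2, fun hx => (h.zero_or_one x).resolve_right fun h1 => hx ((hone x).1 h1)⟩

end CompGroup

namespace CompGroup

/-! ## The index set of a finitely generated nilpotent group is d-`Σ₂` -/

/-- Substitution of constants for the generators. -/
def substConst {n : ℕ} (g : Fin n → ℕ) (t : GTerm ℕ) : GTerm ℕ :=
  t.bind (finExt (fun j => .const (g j)) .one)

theorem computable_substConst {n : ℕ} :
    Computable₂ fun (g : Fin n → ℕ) (t : GTerm ℕ) => substConst g t :=
  GTerm.computable_fold
    (c := fun g : Fin n → ℕ => finExt (fun j => GTerm.const (g j)) GTerm.one)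
    (o := fun _ => GTerm.one) (i := fun _ t => GTerm.inv t) (m := fun _ p => GTerm.mul p.1 p.2)
    (computable_finExt (g := fun (g : Fin n → ℕ) j => GTerm.const (g j))
      (fun j => GTerm.computable_const.comp (Computable.fin_app.comp .id (.const j))) GTerm.one)
    (.const GTerm.one) (GTerm.computable_inv.comp .snd)
    (GTerm.computable_mul.comp (Computable.fst.comp .snd) (Computable.snd.comp .snd))

theorem GTerm.bind_bind {A B C : Type} (f : A → GTerm B) (g : B → GTerm C) (t : GTerm A) :
    (t.bind f).bind g = t.bind fun a => (f a).bind g := by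
  induction t <;> simp_all

theorem substConst_coe {U : Set ℕ} {n : ℕ} (y : Fin n → U) (t : GTerm ℕ) :
    substConst (fun j => (y j : ℕ)) t =
      (t.bind (finExt (fun j => GTerm.const (y j)) .one)).incl := by
  rw [substConst, GTerm.incl, GTerm.bind_bind]
  congr 1
  funext i
  exact (apply_finExt (GTerm.incl (U := U)) (fun j => GTerm.const (y j)) GTerm.one i).symm

/-! ### Reading term equations in a group from its diagram. -/

section Holds

variable {U : Set ℕ} [Group U] {f : ℕ → ℕ}

theorem IsChar.holds_incl_iff (h : IsChar f (atomicDiagram U)) (t s : GTerm U) :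
    Holds f t.incl s.incl ↔ t.lift id = s.lift id := by
  rw [Holds, h.eq_one_iff, eqCode_incl_mem_iff, GTerm.eval_eq_lift, GTerm.eval_eq_lift]

theorem IsChar.holds_const_iff (h : IsChar f (atomicDiagram U)) (a : ℕ) :
    Holds f (.const a) (.const a) ↔ a ∈ U := by
  rw [Holds, h.eq_one_iff, mem_universe_iff]

theorem lift_bind_finExt {n : ℕ} (y : Fin n → U) (t : GTerm ℕ) :
    (t.bind (finExt (fun j => GTerm.const (y j)) .one)).lift id = t.lift (finExt y 1) := by
  rw [GTerm.lift_bind]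
  congr 1
  funext i
  exact apply_finExt (GTerm.lift id) _ _ i

theorem IsChar.holds_substConst_one (h : IsChar f (atomicDiagram U)) {n : ℕ} (y : Fin n → U)
    (t : GTerm ℕ) : Holds f (substConst (fun j => (y j : ℕ)) t) .one ↔
      t.lift (finExt y 1) = 1 := by
  rw [substConst_coe, ← GTerm.incl_one (U := U), h.holds_incl_iff, lift_bind_finExt,
    GTerm.lift_one]

theorem IsChar.holds_substConst_const (h : IsChar f (atomicDiagram U)) {n : ℕ} (y : Fin n → U)
    (t : GTerm ℕ) (a : U) : Holds f (substConst (fun j => (y j : ℕ)) t) (.const (a : ℕ)) ↔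
      t.lift (finExt y 1) = a := by
  rw [substConst_coe, ← GTerm.incl_const, h.holds_incl_iff, lift_bind_finExt, GTerm.lift_const, id]

end Holds

/-! ### Decidability of character certificates. -/

section Cert

/-- The value of a term in the cyclic group of order `m + 1`, as a natural number. -/
def charNat {n : ℕ} (m : ℕ) (a : Fin n → ℕ) (t : GTerm ℕ) : ℕ :=
  t.fold (finExt a 0) 0 (fun v => m * v) fun p => p.1 + p.2

/-- Since `m` is `-1` modulo `m + 1`, multiplication by `m` represents inversion without leaving
`ℕ`. -/
theorem charVal_eq {n : ℕ} (m : ℕ) (a : Fin n → ℕ) (t : GTerm ℕ) :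
    charVal m a t = Multiplicative.ofAdd (charNat m a t : ZMod (m + 1)) := by
  have hm : (m : ZMod (m + 1)) = -1 := by
    rw [eq_neg_iff_add_eq_zero]
    exact_mod_cast ZMod.natCast_self (m + 1)
  induction t with
  | const i =>
    simp only [charVal, charNat, GTerm.lift_const, GTerm.fold]
    rw [apply_finExt (fun v : ℕ => Multiplicative.ofAdd (v : ZMod (m + 1)))]
    simp
  | one => simp [charVal, charNat, GTerm.fold]
  | inv t ih =>
    simp only [charVal, charNat, GTerm.fold, GTerm.lift_inv] at ih ⊢
    rw [ih, Nat.cast_mul, hm, neg_one_mul, ofAdd_neg]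
  | mul t s iht ihs =>
    simp only [charVal, charNat, GTerm.fold, GTerm.lift_mul] at iht ihs ⊢
    rw [iht, ihs, Nat.cast_add, ofAdd_add]

theorem charVal_eq_one_iff {n : ℕ} (m : ℕ) (a : Fin n → ℕ) (t : GTerm ℕ) :
    charVal m a t = 1 ↔ charNat m a t % (m + 1) = 0 := by
  rw [charVal_eq, ofAdd_eq_one, ZMod.natCast_eq_zero_iff, Nat.dvd_iff_mod_eq_zero]

theorem computable_charNat {n : ℕ} :
    Computable₂ fun (p : ℕ × (Fin n → ℕ)) (t : GTerm ℕ) => charNat p.1 p.2 t :=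
  GTerm.computable_fold (c := fun p : ℕ × (Fin n → ℕ) => finExt p.2 0)
    (i := fun p v => p.1 * v) (m := fun _ p => p.1 + p.2)
    (computable_finExt (fun j => Computable.fin_app.comp .snd (.const j)) _) (.const _)
    (Primrec.nat_mul.to_comp.comp (Computable.fst.comp .fst) .snd)
    (Primrec.nat_add.to_comp.comp (Computable.fst.comp .snd) (Computable.snd.comp .snd))

theorem opred_isCharCert {α : Type*} [Primcodable α] {n : ℕ} (rel : List (GTerm ℕ)) {m : α → ℕ}
    {a : α → Fin n → ℕ} {w : α → Fin n → GTerm ℕ} (hm : Computable m) (ha : Computable a)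
    (hw : Computable w) : OPred fun _ x => IsCharCert rel (m x) (a x) (w x) := by
  have hmod : Computable₂ fun k l : ℕ => decide (k % (l + 1) = 0) :=
    ((Primrec.eq (α := ℕ)).decide.comp (Primrec.nat_mod.comp .fst (Primrec.succ.comp .snd))
      (.const 0)).to_comp
  have key : ∀ {k : α → ℕ}, Computable k → OPred fun _ x => k x % (m x + 1) = 0 := fun hk =>
    OPred.of_computablePred (Computable.computablePred (hmod.comp hk hm))
  have h1 := OPred.forall_mem_list rel fun r => key (computable_charNat.comp (hm.pair ha) (.const r))
  have h2 := OPred.forall_fin fun j : Fin n => key (computable_charNat.comp (hm.pair ha)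
    (Computable.fin_app.comp hw (.const j)))
  have h3 := (OPred.forall_fin fun j : Fin n => key (Computable.fin_app.comp ha (.const j))).not
  refine (h1.and (h2.and h3)).of_eq fun f x => ?_
  simp only [IsCharCert, charVal_eq_one_iff, ne_eq, ZMod.natCast_eq_zero_iff,
    Nat.dvd_iff_mod_eq_zero, not_forall, id]

end Cert

/-! ### The isomorphism criterion in arithmetical form. -/

section Upper

variable {N : Type*} [Group N] {n : ℕ}

/-- The data on which the universal conditions of a good tuple depend. -/
abbrev TupleData (n : ℕ) : Type :=
  GTerm ℕ × (Fin n → ℕ) × (Fin n → GTerm ℕ) × ℕ × (Fin n → ℕ)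

/-- The matrix of the universal condition for good tuples, expressed by a diagram. -/
def TupleMatrix (x : Fin n → N) (rel : List (GTerm ℕ)) (f : ℕ → ℕ) (g : Fin n → ℕ)
    (b : TupleData n) : Prop :=
  (∀ j, Holds f (.const (g j)) (.const (g j))) ∧
    (Holds f (substConst g b.1) .one ↔ b.1.lift (finExt x 1) = 1) ∧
    ¬ ((∀ j, Holds f (.const (b.2.1 j)) (.const (b.2.1 j))) ∧
      (∀ r ∈ rel, Holds f (substConst b.2.1 r) .one) ∧
      IsCharCert rel b.2.2.2.1 b.2.2.2.2 b.2.2.1 ∧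
      ∀ j, Holds f (substConst b.2.1 (b.2.2.1 j)) (.const (g j)))

theorem computablePred_lift_eq_one (M : Numbering N) (x : Fin n → N) :
    ComputablePred fun t : GTerm ℕ => t.lift (finExt x 1) = 1 := by
  classical
  choose c hc using fun j => M.surj (x j)
  obtain ⟨u, hu⟩ := M.surj 1
  obtain ⟨F, hF, hv⟩ := M.exists_term_value (α := Unit) (c := fun _ => finExt c u)
    (computable_finExt (fun j => .const (c j)) u)
  refine ComputablePred.of_eq (p := fun t => M.val (F () t) = 1)
    (Computable.computablePred (M.computablePred_eq_one.decide.comp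
      (hF.comp (.const ()) .id))) fun t => ?_
  rw [hv]
  have : (fun i => M.val (finExt c u i)) = finExt x 1 := by
    funext i; rw [apply_finExt M.val]; simp only [hc, hu]
  rw [this]

theorem opred_tupleMatrix (M : Numbering N) (x : Fin n → N) (rel : List (GTerm ℕ)) :
    OPred fun f (p : (Fin n → ℕ) × TupleData n) => TupleMatrix x rel f p.1 p.2 := by
  have hb : Computable fun p : (Fin n → ℕ) × TupleData n => p.2 := .snd
  have hg : Computable fun p : (Fin n → ℕ) × TupleData n => p.1 := .fst
  have ht : Computable fun p : (Fin n → ℕ) × TupleData n => p.2.1 := Computable.fst.comp hb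
  have hb2 : Computable fun p : (Fin n → ℕ) × TupleData n => p.2.2 := Computable.snd.comp hb
  have hy : Computable fun p : (Fin n → ℕ) × TupleData n => p.2.2.1 := Computable.fst.comp hb2
  have hb3 : Computable fun p : (Fin n → ℕ) × TupleData n => p.2.2.2 := Computable.snd.comp hb2
  have hw : Computable fun p : (Fin n → ℕ) × TupleData n => p.2.2.2.1 := Computable.fst.comp hb3
  have hb4 : Computable fun p : (Fin n → ℕ) × TupleData n => p.2.2.2.2 := Computable.snd.comp hb3
  have hm : Computable fun p : (Fin n → ℕ) × TupleData n => p.2.2.2.2.1 := Computable.fst.comp hb4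
  have ha : Computable fun p : (Fin n → ℕ) × TupleData n => p.2.2.2.2.2 := Computable.snd.comp hb4
  have hcst := fun {y : (Fin n → ℕ) × TupleData n → Fin n → ℕ} (hy : Computable y) (j : Fin n) =>
    GTerm.computable_const.comp (Computable.fin_app.comp hy (.const j))
  have hone : Computable fun _ : (Fin n → ℕ) × TupleData n => (.one : GTerm ℕ) := .const _
  have hsub := fun {y : (Fin n → ℕ) × TupleData n → Fin n → ℕ} {t} (hy : Computable y)
    (ht : Computable t) => computable_substConst.comp hy ht
  have hwp : ComputablePred fun p : (Fin n → ℕ) × TupleData n => p.2.1.lift (finExt x 1) = 1 := by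
    classical
    exact Computable.computablePred ((computablePred_lift_eq_one M x).decide.comp ht)
  exact (OPred.forall_fin fun j => OPred.holds (hcst hg j) (hcst hg j)).and
    (((OPred.holds (hsub hg ht) hone).iff (OPred.of_computablePred hwp)).and
    ((OPred.forall_fin fun j => OPred.holds (hcst hy j) (hcst hy j)).and
      ((OPred.forall_mem_list rel fun r => OPred.holds (hsub hy (.const r)) hone).and
      ((opred_isCharCert rel hm ha hw).and
      (OPred.forall_fin fun j => OPred.holds
        (hsub hy (Computable.fin_app.comp hw (.const j))) (hcst hg j))))).not)

theorem IsChar.forall_tupleMatrix_iff {U : Set ℕ} [Group U] {f : ℕ → ℕ}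
    (h : IsChar f (atomicDiagram U)) (x : Fin n → N) (rel : List (GTerm ℕ)) (g : Fin n → ℕ) :
    (∀ b, TupleMatrix x rel f g b) ↔
      ∃ g' : Fin n → U, (g = fun j => (g' j : ℕ)) ∧ IsGoodTuple x rel g' := by
  constructor
  · intro hb
    have hg : ∀ j, g j ∈ U := fun j => (h.holds_const_iff _).1
      -- The first conjunct of the matrix does not depend on the data, so any dummy tuple serves.
      ((hb (.one, fun _ => 0, fun _ => .one, 0, fun _ => 0)).1 j)
    refine ⟨fun j => ⟨g j, hg j⟩, rfl, fun t => ?_, fun y w m a ⟨hy, hc, hw⟩ => ?_⟩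
    · rw [← (hb (t, fun _ => 0, fun _ => .one, 0, fun _ => 0)).2.1]
      exact (h.holds_substConst_one (fun j => ⟨g j, hg j⟩) t).symm
    · refine (hb (.one, fun j => (y j : ℕ), w, m, a)).2.2
        ⟨fun j => (h.holds_const_iff _).2 (y j).2,
          fun r hr => (h.holds_substConst_one y r).2 (hy r hr), hc, fun j => ?_⟩
      exact (h.holds_substConst_const y (w j) ⟨g j, hg j⟩).2 (hw j).symm
  · rintro ⟨g, rfl, hg⟩ ⟨t, y, w, m, a⟩
    refine ⟨fun j => (h.holds_const_iff _).2 (g j).2, ?_, ?_⟩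
    · exact (h.holds_substConst_one g t).trans (hg.1 t)
    · rintro ⟨hy, hr, hc, hw⟩
      have hyU : ∀ j, y j ∈ U := fun j => (h.holds_const_iff _).1 (hy j)
      refine hg.2 (fun j => ⟨y j, hyU j⟩) w m a ⟨fun r hrel => ?_, hc, fun j => ?_⟩
      · exact (h.holds_substConst_one (fun j => ⟨y j, hyU j⟩) r).1 (hr r hrel)
      · exact ((h.holds_substConst_const (fun j => ⟨y j, hyU j⟩) (w j) (g j)).1 (hw j)).symm

/-- All good tuples generate, expressed by a diagram. -/
def GoodTuplesGenerate (x : Fin n → N) (rel : List (GTerm ℕ)) (f : ℕ → ℕ) : Prop :=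
  ∀ p : (Fin n → ℕ) × ℕ, ∃ q : TupleData n × GTerm ℕ,
    ¬ TupleMatrix x rel f p.1 q.1 ∨ ¬ Holds f (.const p.2) (.const p.2) ∨
      Holds f (substConst p.1 q.2) (.const p.2)

theorem isPi2_goodTuplesGenerate (M : Numbering N) (x : Fin n → N) (rel : List (GTerm ℕ)) :
    IsPi2 {e | ∃ f, IsTotal e f ∧ GoodTuplesGenerate x rel f} := by
  refine OPred.isPi2 (α := (Fin n → ℕ) × ℕ) (β := TupleData n × GTerm ℕ)
    (P := fun f r => ¬ TupleMatrix x rel f r.1.1 r.2.1 ∨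
      ¬ Holds f (.const r.1.2) (.const r.1.2) ∨ Holds f (substConst r.1.1 r.2.2) (.const r.1.2)) ?_
  have hz : Computable fun r : ((Fin n → ℕ) × ℕ) × TupleData n × GTerm ℕ =>
      GTerm.const r.1.2 := GTerm.computable_const.comp (Computable.snd.comp .fst)
  exact ((opred_tupleMatrix M x rel).comp
    ((Computable.fst.comp .fst).pair (Computable.fst.comp .snd))).not.or
    ((OPred.holds hz hz).not.or (OPred.holds (computable_substConst.comp
      (Computable.fst.comp .fst) (Computable.snd.comp .snd)) hz))

theorem isPi2_not_exists_goodTuple (M : Numbering N) (x : Fin n → N) (rel : List (GTerm ℕ)) :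
    IsPi2 {e | ∃ f, IsTotal e f ∧ ∀ g, ∃ b, ¬ TupleMatrix x rel f g b} :=
  (opred_tupleMatrix M x rel).not.isPi2

theorem IsChar.goodTuplesGenerate_iff {U : Set ℕ} [Group U] {f : ℕ → ℕ}
    (h : IsChar f (atomicDiagram U)) (x : Fin n → N) (rel : List (GTerm ℕ)) :
    GoodTuplesGenerate x rel f ↔
      ∀ g : Fin n → U, IsGoodTuple x rel g → ∀ z, ∃ t : GTerm ℕ, t.lift (finExt g 1) = z := by
  constructor
  · intro hgen g hg z
    have hM := (h.forall_tupleMatrix_iff x rel _).2 ⟨g, rfl, hg⟩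
    obtain ⟨⟨b, t⟩, hb | hb | hb⟩ := hgen (fun j => (g j : ℕ), z)
    · exact absurd (hM b) hb
    · exact absurd ((h.holds_const_iff _).2 z.2) hb
    · exact ⟨t, (h.holds_substConst_const g t z).1 hb⟩
  · rintro hgen ⟨g, z⟩
    by_cases hM : ∀ b, TupleMatrix x rel f g b
    · obtain ⟨g, rfl, hg⟩ := (h.forall_tupleMatrix_iff x rel _).1 hM
      by_cases hz : z ∈ U
      · obtain ⟨t, ht⟩ := hgen g hg ⟨z, hz⟩
        exact ⟨⟨(.one, fun _ => 0, fun _ => .one, 0, fun _ => 0), t⟩,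
          Or.inr (Or.inr ((h.holds_substConst_const g t ⟨z, hz⟩).2 ht))⟩
      · exact ⟨⟨(.one, fun _ => 0, fun _ => .one, 0, fun _ => 0), .one⟩,
          Or.inr (Or.inl fun h' => hz ((h.holds_const_iff z).1 h'))⟩
    · push Not at hM
      obtain ⟨b, hb⟩ := hM
      exact ⟨(b, .one), Or.inl hb⟩

/-- Being a diagram and having all good tuples generate are `Π₂`; the total indices without a good
tuple also form a `Π₂` set, and are removed. -/
theorem isDSigma2_indexSet [Group.FG N] [hN : Group.IsNilpotent N] :
    IsDSigma2 (indexSet N) := by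
  obtain ⟨M⟩ := nonempty_numbering (G := N)
  obtain ⟨n, x, hx⟩ := exists_fin_generators N
  obtain ⟨c₀, hc₀⟩ := Subgroup.nilpotent_iff_lowerCentralSeries.1 hN
  -- Passing to `c₀ + 1` guarantees a bound of at least 1, as the relator criterion for characters
  -- into abelian groups requires.
  have hc : Subgroup.lowerCentralSeries (⊤ : Subgroup N) (c₀ + 1) = ⊥ :=
    eq_bot_iff.2 (hc₀ ▸ Subgroup.lowerCentralSeries_antitone _ (Nat.le_succ c₀))
  obtain ⟨rel, hrel⟩ := exists_isRelatorList (c₀ + 1) x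
  have hiff := fun (U : Set ℕ) (_ : Group U) =>
    nonempty_mulEquiv_iff (Nat.le_add_left 1 c₀) hc hrel hx U
  have heq : indexSet N = ({e | ∃ f, IsTotal e f ∧ IsDiagramFun f} ∩
      {e | ∃ f, IsTotal e f ∧ GoodTuplesGenerate x rel f}) \
      {e | ∃ f, IsTotal e f ∧ ∀ g, ∃ b, ¬ TupleMatrix x rel f g b} := by
    ext e
    constructor
    · rintro ⟨U, gU, hiso, hchar⟩
      obtain ⟨f, hf, hD⟩ := isCharFun_phi_iff.1 hchar
      obtain ⟨⟨g, hg⟩, hgen⟩ := (hiff U gU).1 hiso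
      refine ⟨⟨⟨f, hf, hD.isDiagramFun⟩, ⟨f, hf, (hD.goodTuplesGenerate_iff x rel).2 hgen⟩⟩, ?_⟩
      rintro ⟨f', hf', hno⟩
      obtain rfl := hf.unique hf'
      obtain ⟨b, hb⟩ := hno fun j => (g j : ℕ)
      exact hb ((hD.forall_tupleMatrix_iff x rel _).2 ⟨g, rfl, hg⟩ b)
    · rintro ⟨⟨⟨f, hf, hdiag⟩, ⟨f', hf', hgen⟩⟩, hno⟩
      obtain rfl := hf.unique hf'
      obtain ⟨U, gU, hD⟩ := hdiag.exists_isChar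
      refine ⟨U, gU, (hiff U gU).2 ⟨?_, (hD.goodTuplesGenerate_iff x rel).1 hgen⟩,
        isCharFun_phi_iff.2 ⟨f, hf, hD⟩⟩
      by_contra hg
      refine hno ⟨f, hf, fun g => ?_⟩
      by_contra! hb
      obtain ⟨g', -, hg'⟩ := (hD.forall_tupleMatrix_iff x rel g).1 hb
      exact hg ⟨g', hg'⟩
  rw [heq]
  exact (isPi2_isDiagramFun.inter (isPi2_goodTuplesGenerate M x rel)).isDSigma2_diff
    (isPi2_not_exists_goodTuple M x rel)

end Upper

end CompGroup

theorem mainTheorem3 (N : Type*) [Group N] [Group.FG N] [Group.IsNilpotent N] :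
    CompGroup.IsHard CompGroup.IsPi2 (CompGroup.indexSet N) ∧
      (¬ CompGroup.IsCoHopfian N →
        CompGroup.IsMComplete CompGroup.IsDSigma2 (CompGroup.indexSet N)) := by
  obtain ⟨M⟩ := CompGroup.nonempty_numbering (G := N)
  refine ⟨CompGroup.isHard_isPi2 M, fun h => ⟨CompGroup.isDSigma2_indexSet, ?_⟩⟩
  obtain ⟨ψ, hψ, hr⟩ := CompGroup.exists_embedding_of_not_isCoHopfian h
  exact CompGroup.isHard_isDSigma2 M hψ hr
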